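/- Let $R$ be a non-zero commutative ring, and let $\tau\colon H\to G$ be a homomorphism of groups. **Definitions.** An $H$-Hom-graded category $\mathcal C$ is a category enriched over $H$-graded $R$-modules: the homogeneous morphisms $X\to Y$ of degree $h$ form an $R$-module $\mathrm{Hom}^h(X,Y)$, identities have degree $1$, and composition is $R$-bilinear $\mathrm{Hom}^{h'}(Y,Z)\times\mathrm{Hom}^{h}(X,Y)\to\mathrm{Hom}^{h'h}(X,Z)$. $\mathcal C^1$ is the $R$-linear category with the same objects and with the morphisms of degree $1$. Functors between $H$-Hom-graded categories are $R$-linear and preserve degrees of morphisms; natural transformations have components of degree $1$. A shift of $X$ by $a\in H$ is an object $X\langle a\rangle$ with an isomorphism $r_{X,a}\colon X\to X\langle a\rangle$ of degree $a$ (with inverse of degree $a^{-1}$); $\mathcal C$ has shifts if all objects have shifts by all $a\in H$. This gives the 2-category $\mathrm{Cat}^{H,\langle\rangle}$ of $H$-Hom-graded categories with shifts. An $H$-module category $(\mathcal C,\alpha)$ is an $R$-linear category with $R$-linear autoequivalences $\alpha^h$ ($h\in H$) and natural isomorphisms $\epsilon\colon\mathrm{id}\to\alpha^1$, $\mu_{a,b}\colon\alpha^a\alpha^b\to\alpha^{ab}$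 satisfying the unit and associativity laws of a monoidal functor. An $H$-module functor $(F,s)\colon(\mathcal C,\alpha)\to(\mathcal D,\beta)$ is an $R$-linear functor $F$ with natural isomorphisms $s^h\colon\beta^hF\to F\alpha^h$ compatible with $\epsilon$ and $\mu$, and $H$-module natural transformations are the natural transformations compatible with $s$. This gives the 2-category $H\text{-}\mathrm{ModCat}$. A $G$-grading of an $R$-linear category $\mathcal D$ is a family of full replete subcategories $\mathcal D_g$ ($g\in G$), each containing all zero objects of $\mathcal D$, with no non-zero morphisms between objects of $\mathcal D_x$ and $\mathcal D_y$ for $x\ne y$, such that each object is a direct sum of finitely many objects $X_g\in\mathcal D_g$ with pairwise different $g$. A $\tau$-graded category is an $H$-Hom-graded category $\mathcal C$ with a $G$-grading of $\mathcal C^1$ such that, for $X\in\mathcal C_x$ and $Y\in\mathcal C_y$, $\mathrm{Hom}^h(X,Y)=0$ unless $y=\tau(h)x$. A $\tau$-module category is an $H$-module category $(\mathcal C,\alpha)$ with a $G$-grading of $\mathcal C$ such that $\alpha^hX\in\mathcal C_{\tau(h)g}$ for all $X\in\mathcal C_g$. The 1-morphisms in both cases are the $H$-Hom-graded functors, resp.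 $H$-module functors, that preserve the degrees of homogeneous objects, and the 2-morphisms are all $H$-Hom-graded, resp. $H$-module, natural transformations between them. This gives the 2-category $\mathrm{Cat}_\tau^{\langle\rangle}$ of $\tau$-graded categories with shifts and the 2-category $H\text{-}\mathrm{ModCat}_\tau$ of $\tau$-module categories. Fix a choice of shifts $r_{X,a}\colon X\to X\langle a\rangle$ in every $H$-Hom-graded category with shifts. The 2-functor $(-)^1\colon\mathrm{Cat}^{H,\langle\rangle}\to H\text{-}\mathrm{ModCat}$ sends $\mathcal C$ to $(\mathcal C^1,\phi)$ with $\phi^aX=X\langle a\rangle$, $\phi^af=r_{Y,a}\circ f\circ r_{X,a}^{-1}$ for $f\colon X\to Y$, $\epsilon_X=r_{X,1}$ and $(\mu_{a,b})_X=r_{X,ab}\circ r_{X,b}^{-1}\circ r_{X\langle b\rangle,a}^{-1}$; it sends $F$ to its restriction with $s^a_X=F(r_{X,a})\circ r_{FX,a}^{-1}$, and keeps the components of 2-morphisms. The 2-functor $(-)^\bullet\colon H\text{-}\mathrm{ModCat}\to\mathrm{Cat}^{H,\langle\rangle}$ sends $(\mathcal C,\alpha)$ to the category with the same objects, with $\mathrm{Hom}^h(X,Y)=\mathrm{Hom}_{\mathcal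 C}(\alpha^hX,Y)$, with identities $\epsilon_X^{-1}$ and with composition $g\circ^\bullet f=g\circ\alpha^{a}f\circ(\mu_{a,b})_X^{-1}$ for $f\colon\alpha^{b}X\to Y$, $g\colon\alpha^{a}Y\to Z$; it sends $(F,s)$ to the functor with $X\mapsto FX$ and $f\mapsto Ff\circ s^h_X$ for $f$ of degree $h$, and a 2-morphism $\eta\colon E\to F$ to the one with components $\eta_X\circ\epsilon_{EX}^{-1}$. **Theorem.** For every choice of shifts, the 2-functors $(-)^1$ and $(-)^\bullet$, keeping the degrees of objects, define 2-functors $$(-)^1\colon \mathrm{Cat}_\tau^{\langle\rangle}\rightleftarrows H\text{-}\mathrm{ModCat}_\tau\colon(-)^\bullet ,$$ which lie over $(-)^1\colon\mathrm{Cat}^{H,\langle\rangle}\rightleftarrows H\text{-}\mathrm{ModCat}\colon(-)^\bullet$ with respect to the 2-functors that forget the degrees of objects. Moreover there are 2-natural isomorphisms $\nu\colon((-)^\bullet)^1\to\mathrm{id}$ and $\eta\colon((-)^1)^\bullet\to\mathrm{id}$, with invertible 1-morphisms as components, that make the latter pair of 2-functors a 2-equivalence $\mathrm{Cat}^{H,\langle\rangle}\simeq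 H\text{-}\mathrm{ModCat}$ and that lift along the forgetful 2-functors to 2-natural isomorphisms making the former pair a 2-equivalence $$\mathrm{Cat}_\tau^{\langle\rangle}\simeq H\text{-}\mathrm{ModCat}_\tau .$$ -/

import Mathlib

open CategoryTheory CategoryTheory.Limits

universe w₁ w₂ v₁ v₂ u₁ u₂ w v u uR uH uG

section HomGraded

variable (R : Type uR) [CommRing R] (H : Type uH) [Group H]

/-- An `H`-Hom-graded `R`-linear category, i.e. a category enriched over `H`-graded `R`-modules:
`Hom h X Y` is the `R`-module of morphisms `X ⟶ Y` that are homogeneous of degree `h`, and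
`comp p g f` is the composite `g ∘ f`. The degree `c` of the composite of morphisms of degrees
`a` and `b` is recorded through an equation `p : a * b = c` (so that no transport along equalities
in `H` is needed); taking `p = rfl` gives the composition
`Hom a Y Z ⊗ Hom b X Y ⟶ Hom (a * b) X Z`. -/
structure HomGradedCat where
  Obj : Type u
  Hom : H → Obj → Obj → Type v
  [addCommGroup : ∀ h X Y, AddCommGroup (Hom h X Y)]
  [module : ∀ h X Y, Module R (Hom h X Y)]
  id : ∀ X, Hom 1 X X
  comp : ∀ {a b c : H} {X Y Z : Obj}, a * b = c → (Hom a Y Z →ₗ[R] Hom b X Y →ₗ[R] Hom c X Z)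
  id_comp : ∀ {a : H} {X Y : Obj} (f : Hom a X Y), comp (one_mul a) (id Y) f = f
  comp_id : ∀ {a : H} {X Y : Obj} (f : Hom a X Y), comp (mul_one a) f (id X) = f
  assoc : ∀ {a b c ab bc abc : H} {W X Y Z : Obj} (hab : a * b = ab) (hbc : b * c = bc)
    (h₁ : ab * c = abc) (h₂ : a * bc = abc) (f : Hom a Y Z) (g : Hom b X Y) (k : Hom c W X),
    comp h₁ (comp hab f g) k = comp h₂ f (comp hbc g k)

attribute [instance] HomGradedCat.addCommGroup HomGradedCat.module

variable {R H}

namespace HomGradedCat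

variable (C : HomGradedCat.{v, u} R H)

/-- The objects of `C`, regarded as the objects of the ordinary category whose morphisms are
the homogeneous morphisms of arbitrary degree (auxiliary, for computations). -/
@[ext]
structure Homog where
  as : C.Obj

instance : Category C.Homog where
  Hom X Y := Σ a : H, C.Hom a X.as Y.as
  id X := ⟨1, C.id X.as⟩
  comp f g := ⟨g.1 * f.1, C.comp rfl g.2 f.2⟩
  id_comp := by
    rintro ⟨X⟩ ⟨Y⟩ ⟨a, f⟩
    have key : ∀ (c : H) (p : a * 1 = c), (⟨c, C.comp p f (C.id X)⟩ : Σ a : H, C.Hom a X Y)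
        = ⟨a, f⟩ := by
      intro c p
      obtain rfl : c = a := by rw [← p, mul_one]
      rw [C.comp_id]
    exact key _ rfl
  comp_id := by
    rintro ⟨X⟩ ⟨Y⟩ ⟨a, f⟩
    have key : ∀ (c : H) (p : 1 * a = c), (⟨c, C.comp p (C.id Y) f⟩ : Σ a : H, C.Hom a X Y)
        = ⟨a, f⟩ := by
      intro c p
      obtain rfl : c = a := by rw [← p, one_mul]
      rw [C.id_comp]
    exact key _ rfl
  assoc := by
    rintro ⟨W⟩ ⟨X⟩ ⟨Y⟩ ⟨Z⟩ ⟨c, k⟩ ⟨b, g⟩ ⟨a, f⟩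
    have key : ∀ (x : H) (p : a * b * c = x),
        (⟨x, C.comp p (C.comp rfl f g) k⟩ : Σ a : H, C.Hom a W Z)
        = ⟨a * (b * c), C.comp rfl f (C.comp rfl g k)⟩ := by
      intro x p
      obtain rfl : x = a * (b * c) := by rw [← p, mul_assoc]
      rw [C.assoc rfl rfl p rfl]
    exact (key _ rfl).symm

variable {C}

/-- A homogeneous morphism of `C`, as a morphism of the auxiliary category `C.Homog`. -/
def toHomog {a : H} {X Y : C.Obj} (f : C.Hom a X Y) : Homog.mk X ⟶ Homog.mk Y :=
  ⟨a, f⟩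

theorem toHomog_injective {a : H} {X Y : C.Obj} {f g : C.Hom a X Y}
    (h : toHomog f = toHomog g) : f = g :=
  eq_of_heq (Sigma.mk.inj h).2

theorem toHomog_comp {a b c : H} {X Y Z : C.Obj} (p : a * b = c) (g : C.Hom a Y Z)
    (f : C.Hom b X Y) : toHomog (C.comp p g f) = toHomog f ≫ toHomog g := by
  subst p; rfl

theorem toHomog_id (X : C.Obj) : toHomog (C.id X) = 𝟙 (Homog.mk X) := rfl

variable (C)

/-- The objects of the `R`-linear category `C¹` (they are the objects of `C`). -/
@[ext]
structure DegOne where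
  as : C.Obj

/-- The category `C¹` with the objects of `C` and the morphisms of degree `1`. -/
instance : Category.{v} C.DegOne where
  Hom X Y := C.Hom 1 X.as Y.as
  id X := C.id X.as
  comp f g := C.comp (one_mul 1) g f
  id_comp f := C.comp_id f
  comp_id f := C.id_comp f
  assoc f g k := (C.assoc _ _ _ _ k g f).symm

instance : Preadditive C.DegOne where
  homGroup X Y := C.addCommGroup 1 X.as Y.as
  add_comp X Y Z f f' g := (C.comp (one_mul 1) (X := X.as) (Y := Y.as) (Z := Z.as) g).map_add f f'
  comp_add X Y Z f g g' := (C.comp (one_mul 1) (X := X.as) (Y := Y.as) (Z := Z.as)).map_add₂ g g' f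

instance : Linear R C.DegOne where
  homModule X Y := C.module 1 X.as Y.as
  smul_comp X Y Z r f g := (C.comp (one_mul 1) (X := X.as) (Y := Y.as) (Z := Z.as) g).map_smul r f
  comp_smul X Y Z f r g :=
    (C.comp (one_mul 1) (X := X.as) (Y := Y.as) (Z := Z.as)).map_smul₂ r g f

/-- A degree `a` isomorphism (its inverse is homogeneous of degree `a⁻¹`). -/
structure DegIso (a : H) (X Y : C.Obj) where
  hom : C.Hom a X Y
  inv : C.Hom a⁻¹ Y X
  hom_inv_id : C.comp (inv_mul_cancel a) inv hom = C.id X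
  inv_hom_id : C.comp (mul_inv_cancel a) hom inv = C.id Y

/-- A shift of `X` by `a`: an object together with a degree `a` isomorphism from `X`. -/
structure Shift (X : C.Obj) (a : H) where
  obj : C.Obj
  iso : C.DegIso a X obj

/-- `C` has shifts if every object has a shift by every element of `H`. -/
def HasShifts : Prop := ∀ (X : C.Obj) (a : H), Nonempty (C.Shift X a)

variable {C}

/-- A degree `a` isomorphism is in particular an isomorphism of `C.Homog`. -/
def DegIso.toIso {a : H} {X Y : C.Obj} (r : C.DegIso a X Y) :
    Homog.mk X ≅ Homog.mk Y where
  hom := toHomog r.hom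
  inv := toHomog r.inv
  hom_inv_id := by rw [← toHomog_comp (inv_mul_cancel a), r.hom_inv_id]; rfl
  inv_hom_id := by rw [← toHomog_comp (mul_inv_cancel a), r.inv_hom_id]; rfl

end HomGradedCat

/-- An `H`-Hom-graded functor: an enriched functor, i.e. an `R`-linear functor that preserves
the degrees of morphisms. -/
structure HomGradedFunctor (C D : HomGradedCat.{v, u} R H) where
  obj : C.Obj → D.Obj
  map : ∀ {a : H} {X Y : C.Obj}, C.Hom a X Y →ₗ[R] D.Hom a (obj X) (obj Y)
  map_id : ∀ X, map (C.id X) = D.id (obj X)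
  map_comp : ∀ {a b c : H} {X Y Z : C.Obj} (p : a * b = c) (g : C.Hom a Y Z) (f : C.Hom b X Y),
    map (C.comp p g f) = D.comp p (map g) (map f)

/-- An `H`-Hom-graded natural transformation: its components are homogeneous of degree `1`. -/
@[ext]
structure HomGradedNatTrans {C D : HomGradedCat.{v, u} R H} (F G : HomGradedFunctor C D) where
  app : ∀ X : C.Obj, D.Hom 1 (F.obj X) (G.obj X)
  naturality : ∀ {a : H} {X Y : C.Obj} (f : C.Hom a X Y),
    D.comp (mul_one a) (G.map f) (app X) = D.comp (one_mul a) (app Y) (F.map f)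

namespace HomGradedFunctor

variable {C D E : HomGradedCat.{v, u} R H}

/-- The identity functor. -/
def id (C : HomGradedCat.{v, u} R H) : HomGradedFunctor C C where
  obj X := X
  map := LinearMap.id
  map_id _ := rfl
  map_comp _ _ _ := rfl

/-- Composition of functors (first `F`, then `G`). -/
def comp (F : HomGradedFunctor C D) (G : HomGradedFunctor D E) : HomGradedFunctor C E where
  obj X := G.obj (F.obj X)
  map := G.map.comp F.map
  map_id X := by simp [F.map_id, G.map_id]
  map_comp p g f := by simp [F.map_comp, G.map_comp]

instance : Category (HomGradedFunctor C D) where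
  Hom F G := HomGradedNatTrans F G
  id F :=
    { app := fun X => D.id (F.obj X)
      naturality := fun f => by rw [D.comp_id, D.id_comp] }
  comp {F G K} η θ :=
    { app := fun X => D.comp (one_mul 1) (θ.app X) (η.app X)
      naturality := fun {a X Y} f => by
        rw [← D.assoc (mul_one a) _ (mul_one a), θ.naturality,
          D.assoc (one_mul a) (mul_one a) (mul_one a) (one_mul a), η.naturality,
          ← D.assoc (one_mul 1) (one_mul a) (one_mul a) (one_mul a)] }
  id_comp η := HomGradedNatTrans.ext (funext fun X => D.comp_id _)
  comp_id η := HomGradedNatTrans.ext (funext fun X => D.id_comp _)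
  assoc η θ κ := HomGradedNatTrans.ext (funext fun X => (D.assoc _ _ _ _ _ _ _).symm)

theorem id_app (F : HomGradedFunctor C D) (X : C.Obj) :
    HomGradedNatTrans.app (𝟙 F) X = D.id (F.obj X) := rfl

theorem comp_app {F G K : HomGradedFunctor C D} (η : F ⟶ G) (θ : G ⟶ K) (X : C.Obj) :
    HomGradedNatTrans.app (η ≫ θ) X = D.comp (one_mul 1) (θ.app X) (η.app X) := rfl

theorem hom_ext {F G : HomGradedFunctor C D} {η θ : F ⟶ G} (h : ∀ X, η.app X = θ.app X) : η = θ :=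
  HomGradedNatTrans.ext (funext h)

/-- Left whiskering. -/
def whiskerLeft (F : HomGradedFunctor C D) {G G' : HomGradedFunctor D E} (η : G ⟶ G') :
    F.comp G ⟶ F.comp G' :=
  HomGradedNatTrans.mk (F := F.comp G) (G := F.comp G') (fun X => η.app (F.obj X))
    (fun f => η.naturality (F.map f))

/-- Right whiskering. -/
def whiskerRight {F F' : HomGradedFunctor C D} (η : F ⟶ F') (G : HomGradedFunctor D E) :
    F.comp G ⟶ F'.comp G :=
  HomGradedNatTrans.mk (F := F.comp G) (G := F'.comp G) (fun X => G.map (η.app X))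
    (fun f => by
      change E.comp _ (G.map (F'.map f)) (G.map (η.app _)) =
        E.comp _ (G.map (η.app _)) (G.map (F.map f))
      rw [← G.map_comp, ← G.map_comp, η.naturality])

end HomGradedFunctor

variable (R H)

/-- The objects of the 2-category `Cat^{H,⟨⟩}`: the `H`-Hom-graded categories with shifts. -/
structure HomGradedShiftCat extends HomGradedCat.{v, u} R H where
  hasShifts : toHomGradedCat.HasShifts

/-- The 2-category `Cat^{H,⟨⟩}` of `H`-Hom-graded categories with shifts, `H`-Hom-graded functors
and `H`-Hom-graded natural transformations. -/
instance : Bicategory (HomGradedShiftCat.{v, u} R H) where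
  Hom C D := HomGradedFunctor C.toHomGradedCat D.toHomGradedCat
  id C := HomGradedFunctor.id C.toHomGradedCat
  comp F G := HomGradedFunctor.comp F G
  homCategory C D := inferInstance
  whiskerLeft F _ _ η := HomGradedFunctor.whiskerLeft F η
  whiskerRight η G := HomGradedFunctor.whiskerRight η G
  associator F G K := Iso.refl (HomGradedFunctor.comp F (HomGradedFunctor.comp G K))
  leftUnitor F := Iso.refl F
  rightUnitor F := Iso.refl F
  whiskerLeft_id _ _ := rfl
  whiskerLeft_comp _ _ _ _ _ _ := rfl
  id_whiskerLeft η := by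
    change _ = 𝟙 _ ≫ η ≫ 𝟙 _
    rw [Category.id_comp, Category.comp_id]; rfl
  comp_whiskerLeft F G _ _ η := by
    change _ = 𝟙 _ ≫ HomGradedFunctor.whiskerLeft F (HomGradedFunctor.whiskerLeft G η) ≫ 𝟙 _
    rw [Category.id_comp, Category.comp_id]; rfl
  id_whiskerRight F G := HomGradedFunctor.hom_ext fun X => G.map_id _
  comp_whiskerRight _ _ G := HomGradedFunctor.hom_ext fun X => G.map_comp _ _ _
  whiskerRight_id η := by
    change _ = 𝟙 _ ≫ η ≫ 𝟙 _
    rw [Category.id_comp, Category.comp_id]; rfl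
  whiskerRight_comp η G K := by
    change _ = 𝟙 _ ≫ HomGradedFunctor.whiskerRight (HomGradedFunctor.whiskerRight η G) K ≫ 𝟙 _
    rw [Category.id_comp, Category.comp_id]; rfl
  whisker_assoc F _ _ η K := by
    change _ = 𝟙 _ ≫ HomGradedFunctor.whiskerLeft F (HomGradedFunctor.whiskerRight η K) ≫ 𝟙 _
    rw [Category.id_comp, Category.comp_id]; rfl
  whisker_exchange η θ := HomGradedFunctor.hom_ext fun X => θ.naturality (η.app X)
  pentagon {_ _ _ D E} F G K L := HomGradedFunctor.hom_ext fun X => by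
    change E.comp _ (E.comp _ (E.id _) (E.id _)) (L.map (D.id _)) = E.comp _ (E.id _) (E.id _)
    rw [L.map_id, E.comp_id]
  triangle {_ D E} F G := HomGradedFunctor.hom_ext fun X => by
    change E.comp _ (E.id _) (E.id _) = G.map (D.id _)
    rw [G.map_id, E.comp_id]

namespace HomGradedFunctor

variable {R H} {C D : HomGradedCat.{v, u} R H}

theorem ext_of_obj {F G : HomGradedFunctor C D} (h : F.obj = G.obj)
    (h' : ∀ (a : H) (X Y : C.Obj) (f : C.Hom a X Y), F.map f ≍ G.map f) : F = G := by
  obtain ⟨o, m, _, _⟩ := F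
  obtain ⟨o', m', _, _⟩ := G
  obtain rfl : o = o' := h
  have : @m = @m' := by
    funext a X Y
    exact LinearMap.ext fun f => eq_of_heq (h' a X Y f)
  subst this
  rfl

theorem eqToHom_app {F G : HomGradedFunctor C D} (h : F = G) (X : C.Obj) :
    HomGradedNatTrans.app (eqToHom h) X ≍ D.id (F.obj X) := by
  subst h; rfl

theorem eqToHom_conj_app {F F' G' G : HomGradedFunctor C D} (h : F = F') (h' : G' = G)
    (η : F' ⟶ G') (X : C.Obj) :
    HomGradedNatTrans.app (eqToHom h ≫ η ≫ eqToHom h') X ≍ η.app X := by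
  subst h h'
  rw [eqToHom_refl, eqToHom_refl, Category.comp_id, Category.id_comp]

end HomGradedFunctor

instance : Bicategory.Strict (HomGradedShiftCat.{v, u} R H) where
  id_comp _ := rfl
  comp_id _ := rfl
  assoc _ _ _ := rfl
  leftUnitor_eqToIso _ := rfl
  rightUnitor_eqToIso _ := rfl
  associator_eqToIso _ _ _ := rfl

end HomGraded

section HModule

variable (R : Type uR) [CommRing R] (H : Type uH) [Group H]

/-- An `H`-module category: an `R`-linear category with an action of `H` by `R`-linear
autoequivalences `act h`, with natural isomorphisms `unit : id ≅ act 1` and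
`mul : act a ∘ act b ≅ act (a * b)` satisfying the unit and associativity laws.
(As above, the product `c` of `a` and `b` is recorded through an equation `a * b = c`.) -/
structure HModCat where
  Obj : Type u
  [category : Category.{v} Obj]
  [preadditive : Preadditive Obj]
  [linear : Linear R Obj]
  act : H → Obj ⥤ Obj
  [act_additive : ∀ h, (act h).Additive]
  [act_linear : ∀ h, (act h).Linear R]
  [act_isEquivalence : ∀ h, (act h).IsEquivalence]
  unit : 𝟭 Obj ≅ act 1
  mul : ∀ {a b c : H}, a * b = c → (act b ⋙ act a ≅ act c)
  unit_mul : ∀ (h : H) (X : Obj),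
    unit.hom.app ((act h).obj X) ≫ (mul (one_mul h)).hom.app X = 𝟙 ((act h).obj X)
  mul_unit : ∀ (h : H) (X : Obj),
    (act h).map (unit.hom.app X) ≫ (mul (mul_one h)).hom.app X = 𝟙 ((act h).obj X)
  mul_assoc : ∀ {a b c ab bc abc : H} (hab : a * b = ab) (hbc : b * c = bc)
    (h₁ : ab * c = abc) (h₂ : a * bc = abc) (X : Obj),
    (mul hab).hom.app ((act c).obj X) ≫ (mul h₁).hom.app X =
      (act a).map ((mul hbc).hom.app X) ≫ (mul h₂).hom.app X

attribute [instance] HModCat.category HModCat.preadditive HModCat.linear HModCat.act_additive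
  HModCat.act_linear HModCat.act_isEquivalence

variable {R H}

/-- An `H`-module functor `(F, s)`: an `R`-linear functor `F` together with natural isomorphisms
`s h : act h ∘ F ≅ F ∘ act h` compatible with `unit` and `mul`. -/
structure HModFunctor (C D : HModCat.{v, u} R H) where
  functor : C.Obj ⥤ D.Obj
  [additive : functor.Additive]
  [linear : functor.Linear R]
  s : ∀ h : H, functor ⋙ D.act h ≅ C.act h ⋙ functor
  s_unit : ∀ X : C.Obj,
    D.unit.hom.app (functor.obj X) ≫ (s 1).hom.app X = functor.map (C.unit.hom.app X)
  s_mul : ∀ {a b c : H} (p : a * b = c) (X : C.Obj),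
    (D.act a).map ((s b).hom.app X) ≫ (s a).hom.app ((C.act b).obj X) ≫
        functor.map ((C.mul p).hom.app X) =
      (D.mul p).hom.app (functor.obj X) ≫ (s c).hom.app X

attribute [instance] HModFunctor.additive HModFunctor.linear

/-- An `H`-module natural transformation. -/
@[ext]
structure HModNatTrans {C D : HModCat.{v, u} R H} (F G : HModFunctor C D) where
  natTrans : F.functor ⟶ G.functor
  comm : ∀ (h : H) (X : C.Obj),
    (F.s h).hom.app X ≫ natTrans.app ((C.act h).obj X) =
      (D.act h).map (natTrans.app X) ≫ (G.s h).hom.app X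

namespace HModFunctor

variable {C D E : HModCat.{v, u} R H}

/-- The identity functor, with `s` the identity. -/
def id (C : HModCat.{v, u} R H) : HModFunctor C C where
  functor := 𝟭 C.Obj
  s h := Iso.refl (C.act h)
  s_unit X := by simp
  s_mul p X := by simp

/-- Composition of functors (first `F`, then `G`): the composite of `(F, s)` and `(G, r)` is
`(G ∘ F, t)` with `t h X = G (s h X) ∘ r h (F X)`. -/
def comp (F : HModFunctor C D) (G : HModFunctor D E) : HModFunctor C E where
  functor := F.functor ⋙ G.functor
  s h := NatIso.ofComponents
    (fun X => (G.s h).app (F.functor.obj X) ≪≫ G.functor.mapIso ((F.s h).app X))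
    (fun {X Y} f => by
      have h₁ := (G.s h).hom.naturality (F.functor.map f)
      have h₂ := (F.s h).hom.naturality f
      dsimp at h₁ h₂ ⊢
      rw [← Category.assoc, h₁, Category.assoc, ← G.functor.map_comp, h₂]
      simp)
  s_unit X := by
    have h₁ := G.s_unit (F.functor.obj X)
    have h₂ := F.s_unit X
    dsimp
    rw [← Category.assoc, h₁, ← G.functor.map_comp, h₂]
  s_mul {a b c} p X := by
    have h₁ := G.s_mul p (F.functor.obj X)
    have h₂ := F.s_mul p X
    have h₃ := (G.s a).hom.naturality ((F.s b).hom.app X)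
    dsimp at h₃ ⊢
    rw [← reassoc_of% h₁, ← G.functor.map_comp, ← h₂]
    simp only [Functor.map_comp, Category.assoc]
    rw [reassoc_of% h₃]

instance : Category (HModFunctor C D) where
  Hom F G := HModNatTrans F G
  id F :=
    { natTrans := 𝟙 F.functor
      comm := fun h X => by simp }
  comp {F G K} η θ :=
    { natTrans := η.natTrans ≫ θ.natTrans
      comm := fun h X => by
        have h₁ := η.comm h X
        have h₂ := θ.comm h X
        dsimp
        rw [← Category.assoc, h₁, Category.assoc, h₂]
        simp }
  id_comp η := HModNatTrans.ext (Category.id_comp _)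
  comp_id η := HModNatTrans.ext (Category.comp_id _)
  assoc η θ κ := HModNatTrans.ext (Category.assoc _ _ _)

theorem id_app (F : HModFunctor C D) (X : C.Obj) :
    (HModNatTrans.natTrans (𝟙 F)).app X = 𝟙 (F.functor.obj X) := rfl

theorem comp_app {F G K : HModFunctor C D} (η : F ⟶ G) (θ : G ⟶ K) (X : C.Obj) :
    (HModNatTrans.natTrans (η ≫ θ)).app X = η.natTrans.app X ≫ θ.natTrans.app X := rfl

theorem hom_ext {F G : HModFunctor C D} {η θ : F ⟶ G}
    (h : ∀ X, η.natTrans.app X = θ.natTrans.app X) : η = θ :=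
  HModNatTrans.ext (NatTrans.ext (funext h))

/-- Left whiskering. -/
def whiskerLeft (F : HModFunctor C D) {G G' : HModFunctor D E} (η : G ⟶ G') :
    F.comp G ⟶ F.comp G' :=
  HModNatTrans.mk (F := F.comp G) (G := F.comp G') (Functor.whiskerLeft F.functor η.natTrans)
    (fun h X => by
      have h₁ := η.comm h (F.functor.obj X)
      have h₂ := η.natTrans.naturality ((F.s h).hom.app X)
      dsimp [comp] at h₂ ⊢
      rw [Category.assoc, h₂, reassoc_of% h₁])

/-- Right whiskering. -/
def whiskerRight {F F' : HModFunctor C D} (η : F ⟶ F') (G : HModFunctor D E) :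
    F.comp G ⟶ F'.comp G :=
  HModNatTrans.mk (F := F.comp G) (G := F'.comp G) (Functor.whiskerRight η.natTrans G.functor)
    (fun h X => by
      have h₁ := η.comm h X
      have h₂ := (G.s h).hom.naturality (η.natTrans.app X)
      dsimp [comp] at h₂ ⊢
      rw [Category.assoc, ← G.functor.map_comp, h₁, reassoc_of% h₂, G.functor.map_comp])

theorem ext_of_functor {F G : HModFunctor C D} (h : F.functor = G.functor)
    (h' : ∀ (h : H) (X : C.Obj), (F.s h).hom.app X ≍ (G.s h).hom.app X) : F = G := by
  obtain ⟨o, m, _, _⟩ := F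
  obtain ⟨o', m', _, _⟩ := G
  obtain rfl : o = o' := h
  have : m = m' := by
    funext a
    exact Iso.ext (NatTrans.ext (funext fun X => eq_of_heq (h' a X)))
  subst this
  rfl

theorem eqToHom_app {F G : HModFunctor C D} (h : F = G) (X : C.Obj) :
    (HModNatTrans.natTrans (eqToHom h)).app X ≍ 𝟙 (F.functor.obj X) := by
  subst h; rfl

theorem eqToHom_conj_app {F F' G' G : HModFunctor C D} (h : F = F') (h' : G' = G) (η : F' ⟶ G')
    (X : C.Obj) : (HModNatTrans.natTrans (eqToHom h ≫ η ≫ eqToHom h')).app X ≍ η.natTrans.app X := by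
  subst h h'
  rw [eqToHom_refl, eqToHom_refl, Category.comp_id, Category.id_comp]

end HModFunctor

/-- The 2-category of `H`-module categories, `H`-module functors and `H`-module natural
transformations. -/
instance : Bicategory (HModCat.{v, u} R H) where
  Hom C D := HModFunctor C D
  id C := HModFunctor.id C
  comp F G := HModFunctor.comp F G
  homCategory C D := inferInstance
  whiskerLeft F _ _ η := HModFunctor.whiskerLeft F η
  whiskerRight η G := HModFunctor.whiskerRight η G
  associator F G K :=
    { hom := HModNatTrans.mk (𝟙 (F.functor ⋙ G.functor ⋙ K.functor)) (fun h X => by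
        dsimp [HModFunctor.comp]; simp)
      inv := HModNatTrans.mk (𝟙 (F.functor ⋙ G.functor ⋙ K.functor)) (fun h X => by
        dsimp [HModFunctor.comp]; simp)
      hom_inv_id := HModFunctor.hom_ext fun X => Category.comp_id _
      inv_hom_id := HModFunctor.hom_ext fun X => Category.comp_id _ }
  leftUnitor F :=
    { hom := HModNatTrans.mk (𝟙 F.functor) (fun h X => by
        dsimp [HModFunctor.comp, HModFunctor.id]; simp)
      inv := HModNatTrans.mk (𝟙 F.functor) (fun h X => by
        dsimp [HModFunctor.comp, HModFunctor.id]; simp)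
      hom_inv_id := HModFunctor.hom_ext fun X => Category.comp_id _
      inv_hom_id := HModFunctor.hom_ext fun X => Category.comp_id _ }
  rightUnitor F :=
    { hom := HModNatTrans.mk (𝟙 F.functor) (fun h X => by
        dsimp [HModFunctor.comp, HModFunctor.id]; simp)
      inv := HModNatTrans.mk (𝟙 F.functor) (fun h X => by
        dsimp [HModFunctor.comp, HModFunctor.id]; simp)
      hom_inv_id := HModFunctor.hom_ext fun X => Category.comp_id _
      inv_hom_id := HModFunctor.hom_ext fun X => Category.comp_id _ }
  whiskerLeft_id _ _ := rfl
  whiskerLeft_comp _ _ _ _ _ _ := rfl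
  id_whiskerLeft η := HModFunctor.hom_ext fun X => by
    change η.natTrans.app X = 𝟙 _ ≫ η.natTrans.app X ≫ 𝟙 _
    simp
  comp_whiskerLeft F G _ _ η := HModFunctor.hom_ext fun X => by
    change η.natTrans.app (G.functor.obj (F.functor.obj X)) = 𝟙 _ ≫ η.natTrans.app _ ≫ 𝟙 _
    simp
  id_whiskerRight F G := HModFunctor.hom_ext fun X => G.functor.map_id _
  comp_whiskerRight _ _ G := HModFunctor.hom_ext fun X => G.functor.map_comp _ _
  whiskerRight_id η := HModFunctor.hom_ext fun X => by
    change η.natTrans.app X = 𝟙 _ ≫ η.natTrans.app X ≫ 𝟙 _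
    simp
  whiskerRight_comp η G K := HModFunctor.hom_ext fun X => by
    change K.functor.map (G.functor.map (η.natTrans.app X)) = 𝟙 _ ≫ K.functor.map _ ≫ 𝟙 _
    simp; rfl
  whisker_assoc F _ _ η K := HModFunctor.hom_ext fun X => by
    change K.functor.map (η.natTrans.app (F.functor.obj X)) = 𝟙 _ ≫ K.functor.map _ ≫ 𝟙 _
    simp
  whisker_exchange η θ := HModFunctor.hom_ext fun X =>
    (θ.natTrans.naturality (η.natTrans.app X)).symm
  pentagon {_ _ _ D E} F G K L := HModFunctor.hom_ext fun X => by
    change L.functor.map (𝟙 _) ≫ 𝟙 _ ≫ 𝟙 _ = 𝟙 _ ≫ 𝟙 _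
    simp
  triangle {_ D E} F G := HModFunctor.hom_ext fun X => by
    change 𝟙 _ ≫ 𝟙 _ = G.functor.map (𝟙 _)
    simp

namespace HModFunctor

variable {C D E K : HModCat.{v, u} R H}

theorem id_comp' (F : HModFunctor C D) : (HModFunctor.id C).comp F = F :=
  ext_of_functor rfl fun h X => heq_of_eq (by
    change (F.s h).hom.app X ≫ F.functor.map (𝟙 _) = _
    simp)

theorem comp_id' (F : HModFunctor C D) : F.comp (HModFunctor.id D) = F :=
  ext_of_functor rfl fun h X => heq_of_eq (by
    change 𝟙 _ ≫ (F.s h).hom.app X = _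
    simp)

theorem assoc' (F : HModFunctor C D) (G : HModFunctor D E) (L : HModFunctor E K) :
    (F.comp G).comp L = F.comp (G.comp L) :=
  ext_of_functor rfl fun h X => heq_of_eq (by
    dsimp [comp]
    simp)

end HModFunctor

instance : Bicategory.Strict (HModCat.{v, u} R H) where
  id_comp F := HModFunctor.id_comp' F
  comp_id F := HModFunctor.comp_id' F
  assoc F G K := HModFunctor.assoc' F G K
  leftUnitor_eqToIso F := Iso.ext (HModFunctor.hom_ext fun X =>
    (eq_of_heq (HModFunctor.eqToHom_app (HModFunctor.id_comp' F) X)).symm)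
  rightUnitor_eqToIso F := Iso.ext (HModFunctor.hom_ext fun X =>
    (eq_of_heq (HModFunctor.eqToHom_app (HModFunctor.comp_id' F) X)).symm)
  associator_eqToIso F G K := Iso.ext (HModFunctor.hom_ext fun X =>
    (eq_of_heq (HModFunctor.eqToHom_app (HModFunctor.assoc' F G K) X)).symm)

end HModule

section DegreeOne

variable {R : Type uR} [CommRing R] {H : Type uH} [Group H]

namespace HomGradedCat

variable {C : HomGradedCat.{v, u} R H}

/-- A morphism of degree `1`, as a morphism of `C¹`. -/
def DegOne.mkHom {X Y : C.DegOne} (f : C.Hom 1 X.as Y.as) : X ⟶ Y := f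

/-- A morphism of `C¹`, as a morphism of degree `1`. -/
def DegOne.unHom {X Y : C.DegOne} (f : X ⟶ Y) : C.Hom 1 X.as Y.as := f

/-- A morphism of `C¹`, as a morphism of `C.Homog`. -/
def DegOne.hm {X Y : C.DegOne} (f : X ⟶ Y) : Homog.mk X.as ⟶ Homog.mk Y.as :=
  toHomog (DegOne.unHom f)

theorem DegOne.hm_mk {X Y : C.DegOne} (f : C.Hom 1 X.as Y.as) :
    DegOne.hm (DegOne.mkHom f : X ⟶ Y) = toHomog f := rfl

theorem DegOne.toHomog_unHom {X Y : C.DegOne} (f : X ⟶ Y) :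
    toHomog (DegOne.unHom f) = DegOne.hm f := rfl

theorem DegOne.hm_id (X : C.DegOne) : DegOne.hm (𝟙 X) = 𝟙 (Homog.mk X.as) := rfl

theorem DegOne.hm_comp {X Y Z : C.DegOne} (f : X ⟶ Y) (g : Y ⟶ Z) :
    DegOne.hm (f ≫ g) = DegOne.hm f ≫ DegOne.hm g := toHomog_comp _ _ _

theorem DegOne.hm_inj {X Y : C.DegOne} {f g : X ⟶ Y} (h : DegOne.hm f = DegOne.hm g) : f = g :=
  toHomog_injective h

theorem toHomog_inv {a : H} {X Y : C.Obj} (r : C.DegIso a X Y) :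
    toHomog r.inv = r.toIso.inv := rfl

theorem toHomog_hom {a : H} {X Y : C.Obj} (r : C.DegIso a X Y) :
    toHomog r.hom = r.toIso.hom := rfl

/-- An isomorphism of `C¹` from a pair of mutually inverse degree `1` morphisms. -/
def DegOne.mkIso {X Y : C.DegOne} (f : C.Hom 1 X.as Y.as) (g : C.Hom 1 Y.as X.as)
    (e : Homog.mk X.as ≅ Homog.mk Y.as) (hf : toHomog f = e.hom) (hg : toHomog g = e.inv) :
    X ≅ Y where
  hom := DegOne.mkHom f
  inv := DegOne.mkHom g
  hom_inv_id := DegOne.hm_inj (by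
    rw [DegOne.hm_comp, DegOne.hm_mk, DegOne.hm_mk, hf, hg, e.hom_inv_id, DegOne.hm_id])
  inv_hom_id := DegOne.hm_inj (by
    rw [DegOne.hm_comp, DegOne.hm_mk, DegOne.hm_mk, hf, hg, e.inv_hom_id, DegOne.hm_id])

variable (σ : ∀ (X : C.Obj) (a : H), C.Shift X a)

/-- The endofunctor of `C¹` given by a choice of shifts: on objects it is `X ↦ X⟨a⟩`, and it sends
`f` to `r_Y ∘ f ∘ r_X⁻¹`, where `r_X : X ⟶ X⟨a⟩` are the chosen degree `a` isomorphisms. -/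
abbrev shiftFunctor (a : H) : C.DegOne ⥤ C.DegOne where
  obj X := ⟨(σ X.as a).obj⟩
  map {X Y} f := DegOne.mkHom (C.comp (mul_inv_cancel a)
    (C.comp (mul_one a) (σ Y.as a).iso.hom (DegOne.unHom f)) (σ X.as a).iso.inv)
  map_id X := DegOne.hm_inj (by
    simp only [DegOne.hm_mk, DegOne.hm_id, toHomog_comp, toHomog_inv, toHomog_hom,
      DegOne.toHomog_unHom]
    simp)
  map_comp {X Y Z} f g := DegOne.hm_inj (by
    simp only [DegOne.hm_mk, DegOne.hm_comp, toHomog_comp, toHomog_inv, toHomog_hom,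
      DegOne.toHomog_unHom]
    simp)

theorem hm_shiftFunctor_map (a : H) {X Y : C.DegOne} (f : X ⟶ Y) :
    DegOne.hm ((shiftFunctor σ a).map f) =
      (σ X.as a).iso.toIso.inv ≫ DegOne.hm f ≫ (σ Y.as a).iso.toIso.hom := by
  simp only [DegOne.hm_mk, toHomog_comp, toHomog_inv, toHomog_hom,
      DegOne.toHomog_unHom]

instance (a : H) : (shiftFunctor σ a).Additive where
  map_add {X Y f g} := by
    change C.comp (mul_inv_cancel a) (C.comp (mul_one a) (σ Y.as a).iso.hom
      (DegOne.unHom f + DegOne.unHom g)) (σ X.as a).iso.inv = _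
    rw [map_add, map_add]; rfl

instance (a : H) : (shiftFunctor σ a).Linear R where
  map_smul {X Y} f r := by
    change C.comp (mul_inv_cancel a) (C.comp (mul_one a) (σ Y.as a).iso.hom
      (r • DegOne.unHom f)) (σ X.as a).iso.inv = _
    rw [map_smul, map_smul]; rfl

/-- The isomorphism `X ≅ X⟨1⟩` of `C¹` given by `r_{X,1}`. -/
def shiftUnitApp (X : C.DegOne) : X ≅ (shiftFunctor σ 1).obj X :=
  DegOne.mkIso (σ X.as 1).iso.hom
    (C.comp (by simp : (1 : H) * 1⁻¹ = 1) (C.id X.as) (σ X.as 1).iso.inv)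
    (σ X.as 1).iso.toIso rfl (by
      rw [toHomog_comp, toHomog_inv, toHomog_id, Category.comp_id])

/-- The isomorphism `X⟨b⟩⟨a⟩ ≅ X⟨c⟩` of `C¹`, where `a * b = c`, given by
`r_{X,c} ∘ r_{X,b}⁻¹ ∘ r_{X⟨b⟩,a}⁻¹`. -/
def shiftMulApp {a b c : H} (p : a * b = c) (X : C.DegOne) :
    (shiftFunctor σ a).obj ((shiftFunctor σ b).obj X) ≅ (shiftFunctor σ c).obj X :=
  DegOne.mkIso
    (C.comp (by rw [← p]; simp : c * (b⁻¹ * a⁻¹) = 1) (σ X.as c).iso.hom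
      (C.comp rfl (σ X.as b).iso.inv (σ (σ X.as b).obj a).iso.inv))
    (C.comp (by rw [← p]; simp : (a * b) * c⁻¹ = 1)
      (C.comp rfl (σ (σ X.as b).obj a).iso.hom (σ X.as b).iso.hom) (σ X.as c).iso.inv)
    ((σ (σ X.as b).obj a).iso.toIso.symm ≪≫ (σ X.as b).iso.toIso.symm ≪≫ (σ X.as c).iso.toIso)
    (by simp only [toHomog_comp, toHomog_inv, toHomog_hom]; simp)
    (by simp only [toHomog_comp, toHomog_inv, toHomog_hom]; simp)

theorem hm_shiftUnitApp (X : C.DegOne) :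
    DegOne.hm (shiftUnitApp σ X).hom = (σ X.as 1).iso.toIso.hom := rfl

theorem hm_shiftMulApp {a b c : H} (p : a * b = c) (X : C.DegOne) :
    DegOne.hm (shiftMulApp σ p X).hom = (σ (σ X.as b).obj a).iso.toIso.inv ≫
      (σ X.as b).iso.toIso.inv ≫ (σ X.as c).iso.toIso.hom := by
  simp only [shiftMulApp, DegOne.mkIso, DegOne.hm_mk, toHomog_comp, toHomog_inv, toHomog_hom,
    Category.assoc]

/-- The natural isomorphism with components `r_{X,1}`. -/
def shiftUnit : 𝟭 C.DegOne ≅ shiftFunctor σ 1 :=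
  NatIso.ofComponents (fun X => shiftUnitApp σ X) (fun {X Y} f => DegOne.hm_inj (by
    dsimp only [Functor.id_obj, Functor.id_map]
    rw [DegOne.hm_comp, DegOne.hm_comp, hm_shiftFunctor_map, hm_shiftUnitApp, hm_shiftUnitApp]
    simp))

/-- The natural isomorphism with components `r_{X,c} ∘ r_{X,b}⁻¹ ∘ r_{X⟨b⟩,a}⁻¹`. -/
def shiftMul {a b c : H} (p : a * b = c) :
    shiftFunctor σ b ⋙ shiftFunctor σ a ≅ shiftFunctor σ c :=
  NatIso.ofComponents (fun X => shiftMulApp σ p X) (fun {X Y} f => DegOne.hm_inj (by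
    change DegOne.hm ((shiftFunctor σ a).map ((shiftFunctor σ b).map f) ≫ (shiftMulApp σ p Y).hom) =
      DegOne.hm ((shiftMulApp σ p X).hom ≫ (shiftFunctor σ c).map f)
    rw [DegOne.hm_comp, DegOne.hm_comp, hm_shiftFunctor_map, hm_shiftFunctor_map,
      hm_shiftFunctor_map, hm_shiftMulApp, hm_shiftMulApp]
    simp))

instance (a : H) : (shiftFunctor σ a).IsEquivalence :=
  (CategoryTheory.Equivalence.mk (shiftFunctor σ a) (shiftFunctor σ a⁻¹)
    (shiftUnit σ ≪≫ (shiftMul σ (inv_mul_cancel a)).symm)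
    (shiftMul σ (mul_inv_cancel a) ≪≫ (shiftUnit σ).symm)).isEquivalence_functor

/-- The `H`-module category `(C¹, φ)` given by a choice of shifts. -/
abbrev degOneMod : HModCat.{v, u} R H where
  Obj := C.DegOne
  act a := shiftFunctor σ a
  unit := shiftUnit σ
  mul p := shiftMul σ p
  unit_mul h X := DegOne.hm_inj (by
    change DegOne.hm ((shiftUnitApp σ ((shiftFunctor σ h).obj X)).hom ≫
      (shiftMulApp σ (one_mul h) X).hom) = _
    rw [DegOne.hm_comp, hm_shiftUnitApp, hm_shiftMulApp]
    change _ = 𝟙 (Homog.mk (σ X.as h).obj)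
    simp)
  mul_unit h X := DegOne.hm_inj (by
    change DegOne.hm ((shiftFunctor σ h).map (shiftUnitApp σ X).hom ≫
      (shiftMulApp σ (mul_one h) X).hom) = _
    rw [DegOne.hm_comp, hm_shiftFunctor_map, hm_shiftUnitApp, hm_shiftMulApp]
    change _ = 𝟙 (Homog.mk (σ X.as h).obj)
    simp)
  mul_assoc {a b c ab bc abc} hab hbc h₁ h₂ X := DegOne.hm_inj (by
    change DegOne.hm ((shiftMulApp σ hab ((shiftFunctor σ c).obj X)).hom ≫
      (shiftMulApp σ h₁ X).hom) =
      DegOne.hm ((shiftFunctor σ a).map (shiftMulApp σ hbc X).hom ≫ (shiftMulApp σ h₂ X).hom)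
    rw [DegOne.hm_comp, DegOne.hm_comp, hm_shiftFunctor_map, hm_shiftMulApp, hm_shiftMulApp,
      hm_shiftMulApp, hm_shiftMulApp]
    simp)

end HomGradedCat

open HomGradedCat in
/-- The restriction `F¹ : C¹ ⟶ D¹` of a Hom-graded functor to morphisms of degree `1`. -/
abbrev HomGradedFunctor.degOneFunctor {C D : HomGradedCat.{v, u} R H} (F : HomGradedFunctor C D) :
    C.DegOne ⥤ D.DegOne where
  obj X := ⟨F.obj X.as⟩
  map {X Y} f := DegOne.mkHom (F.map (DegOne.unHom f))
  map_id X := F.map_id X.as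
  map_comp f g := F.map_comp (one_mul 1) (DegOne.unHom g) (DegOne.unHom f)

instance {C D : HomGradedCat.{v, u} R H} (F : HomGradedFunctor C D) : F.degOneFunctor.Additive where
  map_add {X Y f g} := F.map.map_add (HomGradedCat.DegOne.unHom f) (HomGradedCat.DegOne.unHom g)

instance {C D : HomGradedCat.{v, u} R H} (F : HomGradedFunctor C D) :
    F.degOneFunctor.Linear R where
  map_smul {X Y} f r := F.map.map_smul r (HomGradedCat.DegOne.unHom f)

namespace HomGradedFunctor

open HomGradedCat

variable {C D E : HomGradedCat.{v, u} R H} (F : HomGradedFunctor C D)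

/-- A Hom-graded functor preserves degree `a` isomorphisms. -/
def mapDegIso {a : H} {X Y : C.Obj} (r : C.DegIso a X Y) : D.DegIso a (F.obj X) (F.obj Y) where
  hom := F.map r.hom
  inv := F.map r.inv
  hom_inv_id := by rw [← F.map_comp, r.hom_inv_id, F.map_id]
  inv_hom_id := by rw [← F.map_comp, r.inv_hom_id, F.map_id]

/-- The action of `F` on homogeneous morphisms. -/
def hmap {X Y : C.Homog} (f : X ⟶ Y) : Homog.mk (F.obj X.as) ⟶ Homog.mk (F.obj Y.as) :=
  ⟨f.1, F.map f.2⟩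

theorem hmap_id (X : C.Homog) : F.hmap (𝟙 X) = 𝟙 (Homog.mk (F.obj X.as)) := by
  change (⟨1, F.map (C.id X.as)⟩ : Σ a : H, D.Hom a _ _) = ⟨1, D.id _⟩
  rw [F.map_id]

theorem hmap_comp {X Y Z : C.Homog} (f : X ⟶ Y) (g : Y ⟶ Z) :
    F.hmap (f ≫ g) = F.hmap f ≫ F.hmap g := by
  change (⟨g.1 * f.1, F.map (C.comp rfl g.2 f.2)⟩ : Σ a : H, D.Hom a _ _) =
    ⟨g.1 * f.1, D.comp rfl (F.map g.2) (F.map f.2)⟩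
  rw [F.map_comp]

/-- The action of `F` on isomorphisms of `C.Homog`. -/
def hmapIso {X Y : C.Homog} (e : X ≅ Y) :
    Homog.mk (F.obj X.as) ≅ Homog.mk (F.obj Y.as) where
  hom := F.hmap e.hom
  inv := F.hmap e.inv
  hom_inv_id := by rw [← hmap_comp, e.hom_inv_id, hmap_id]
  inv_hom_id := by rw [← hmap_comp, e.inv_hom_id, hmap_id]

theorem hmap_hom_inv_assoc {X Y : C.Homog} (e : X ≅ Y) {Z : D.Homog}
    (g : Homog.mk (F.obj X.as) ⟶ Z) : F.hmap e.hom ≫ F.hmap e.inv ≫ g = g :=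
  (F.hmapIso e).hom_inv_id_assoc g

theorem toHomog_map {a : H} {X Y : C.Obj} (f : C.Hom a X Y) :
    toHomog (F.map f) = F.hmap (toHomog f) := rfl

theorem hm_degOneFunctor_map {X Y : C.DegOne} (f : X ⟶ Y) :
    DegOne.hm (F.degOneFunctor.map f) = F.hmap (DegOne.hm f) := rfl

theorem mapDegIso_toIso {a : H} {X Y : C.Obj} (r : C.DegIso a X Y) :
    (F.mapDegIso r).toIso = F.hmapIso r.toIso := rfl

variable (σ : ∀ (X : C.Obj) (a : H), C.Shift X a) (ρ : ∀ (X : D.Obj) (a : H), D.Shift X a)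

/-- The component `F r_{X,a} ∘ r_{FX,a}⁻¹ : (FX)⟨a⟩ ≅ F(X⟨a⟩)`. -/
def shiftCompApp (a : H) (X : C.DegOne) :
    (shiftFunctor ρ a).obj (F.degOneFunctor.obj X) ≅ F.degOneFunctor.obj ((shiftFunctor σ a).obj X) :=
  DegOne.mkIso
    (D.comp (mul_inv_cancel a) (F.map (σ X.as a).iso.hom) (ρ (F.obj X.as) a).iso.inv)
    (D.comp (mul_inv_cancel a) (ρ (F.obj X.as) a).iso.hom (F.map (σ X.as a).iso.inv))
    ((ρ (F.obj X.as) a).iso.toIso.symm ≪≫ F.hmapIso (σ X.as a).iso.toIso)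
    (by rw [toHomog_comp]; rfl) (by rw [toHomog_comp]; rfl)

theorem hm_shiftCompApp (a : H) (X : C.DegOne) :
    DegOne.hm (F.shiftCompApp σ ρ a X).hom = (ρ (F.obj X.as) a).iso.toIso.inv ≫
      F.hmap (σ X.as a).iso.toIso.hom := toHomog_comp _ _ _

/-- The `H`-module functor `(F¹, s_F)`, where `s_F` has components `F r_{X,a} ∘ r_{FX,a}⁻¹`. -/
abbrev degOneModFunctor : HModFunctor (degOneMod σ) (degOneMod ρ) where
  functor := F.degOneFunctor
  s a := NatIso.ofComponents (fun X => F.shiftCompApp σ ρ a X) (fun {X Y} f => DegOne.hm_inj (by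
    change DegOne.hm ((shiftFunctor ρ a).map (F.degOneFunctor.map f) ≫
        (F.shiftCompApp σ ρ a Y).hom) =
      DegOne.hm ((F.shiftCompApp σ ρ a X).hom ≫ F.degOneFunctor.map ((shiftFunctor σ a).map f))
    rw [DegOne.hm_comp, DegOne.hm_comp, hm_shiftFunctor_map, hm_degOneFunctor_map,
      hm_degOneFunctor_map, hm_shiftCompApp, hm_shiftCompApp, hm_shiftFunctor_map]
    simp only [hmap_comp, Category.assoc, Iso.hom_inv_id_assoc, hmap_hom_inv_assoc]))
  s_unit X := DegOne.hm_inj (by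
    change DegOne.hm ((shiftUnitApp ρ (F.degOneFunctor.obj X)).hom ≫
        (F.shiftCompApp σ ρ 1 X).hom) =
      DegOne.hm (F.degOneFunctor.map (shiftUnitApp σ X).hom)
    rw [DegOne.hm_comp, hm_degOneFunctor_map, hm_shiftCompApp, hm_shiftUnitApp, hm_shiftUnitApp,
      Iso.hom_inv_id_assoc])
  s_mul {a b c} p X := DegOne.hm_inj (by
    change DegOne.hm ((shiftFunctor ρ a).map (F.shiftCompApp σ ρ b X).hom ≫
        (F.shiftCompApp σ ρ a ((shiftFunctor σ b).obj X)).hom ≫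
        F.degOneFunctor.map (shiftMulApp σ p X).hom) =
      DegOne.hm ((shiftMulApp ρ p (F.degOneFunctor.obj X)).hom ≫ (F.shiftCompApp σ ρ c X).hom)
    rw [DegOne.hm_comp, DegOne.hm_comp, DegOne.hm_comp, hm_shiftFunctor_map,
      hm_degOneFunctor_map, hm_shiftCompApp, hm_shiftCompApp, hm_shiftCompApp, hm_shiftMulApp,
      hm_shiftMulApp]
    simp only [hmap_comp, Category.assoc, Iso.hom_inv_id_assoc, hmap_hom_inv_assoc])

variable {F}

/-- The `H`-module natural transformation `η¹` with the components of `η`. -/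
abbrev degOneModNatTrans {G : HomGradedFunctor C D} (η : F ⟶ G) :
    F.degOneModFunctor σ ρ ⟶ G.degOneModFunctor σ ρ :=
  HModNatTrans.mk (F := F.degOneModFunctor σ ρ) (G := G.degOneModFunctor σ ρ)
    { app := fun X => DegOne.mkHom (η.app X.as)
      naturality := fun X Y f => (η.naturality (DegOne.unHom f)).symm }
    (fun h X => DegOne.hm_inj (by
      change DegOne.hm ((F.shiftCompApp σ ρ h X).hom ≫ DegOne.mkHom (η.app (σ X.as h).obj)) =
        DegOne.hm ((shiftFunctor ρ h).map (DegOne.mkHom (η.app X.as)) ≫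
          (G.shiftCompApp σ ρ h X).hom)
      have key := congrArg toHomog (η.naturality (σ X.as h).iso.hom)
      rw [toHomog_comp, toHomog_comp, toHomog_map, toHomog_map, toHomog_hom] at key
      rw [DegOne.hm_comp, DegOne.hm_comp, hm_shiftFunctor_map, hm_shiftCompApp, hm_shiftCompApp,
        DegOne.hm_mk, DegOne.hm_mk, Category.assoc, ← key]
      simp))

end HomGradedFunctor

namespace HomGradedFunctor

open HomGradedCat

variable {C D E : HomGradedCat.{v, u} R H}

theorem degOneModFunctor_id (σ : ∀ (X : C.Obj) (a : H), C.Shift X a) :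
    (HomGradedFunctor.id C).degOneModFunctor σ σ = HModFunctor.id (degOneMod σ) :=
  HModFunctor.ext_of_functor rfl fun h X => heq_of_eq (DegOne.hm_inj (by
    change DegOne.hm ((HomGradedFunctor.id C).shiftCompApp σ σ h X).hom = 𝟙 _
    rw [hm_shiftCompApp]
    exact Iso.inv_hom_id (σ X.as h).iso.toIso))

theorem degOneModFunctor_comp (F : HomGradedFunctor C D) (G : HomGradedFunctor D E)
    (σ : ∀ (X : C.Obj) (a : H), C.Shift X a) (ρ : ∀ (X : D.Obj) (a : H), D.Shift X a)
    (π : ∀ (X : E.Obj) (a : H), E.Shift X a) :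
    (F.comp G).degOneModFunctor σ π =
      (F.degOneModFunctor σ ρ).comp (G.degOneModFunctor ρ π) :=
  HModFunctor.ext_of_functor rfl fun h X => heq_of_eq (DegOne.hm_inj (by
    change DegOne.hm ((F.comp G).shiftCompApp σ π h X).hom =
      DegOne.hm ((G.shiftCompApp ρ π h (F.degOneFunctor.obj X)).hom ≫
        G.degOneFunctor.map (F.shiftCompApp σ ρ h X).hom)
    rw [DegOne.hm_comp, hm_degOneFunctor_map, hm_shiftCompApp, hm_shiftCompApp, hm_shiftCompApp]
    rw [hmap_comp, Category.assoc, hmap_hom_inv_assoc]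
    rfl))

end HomGradedFunctor

variable (R H) in
/-- A choice of shifts in every `H`-Hom-graded category with shifts. -/
def ShiftChoice : Type _ :=
  ∀ (C : HomGradedShiftCat.{v, u} R H) (X : C.Obj) (a : H), C.Shift X a

instance : Nonempty (ShiftChoice.{v, u} R H) :=
  ⟨fun C X a => (C.hasShifts X a).some⟩

/-- The 2-functor `(-)¹` from `H`-Hom-graded categories with shifts to `H`-module categories,
defined by a choice of shifts. -/
def degOne (σ : ShiftChoice.{v, u} R H) :
    StrictPseudofunctor (HomGradedShiftCat.{v, u} R H) (HModCat.{v, u} R H) :=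
  StrictPseudofunctor.mk''
    { obj := fun C => HomGradedCat.degOneMod (σ C)
      map := fun {C D} F => HomGradedFunctor.degOneModFunctor F (σ C) (σ D)
      map₂ := fun {C D _ _} η => HomGradedFunctor.degOneModNatTrans (σ C) (σ D) η
      map₂_id := fun F => rfl
      map₂_comp := fun η θ => rfl
      map_id := fun C => HomGradedFunctor.degOneModFunctor_id (σ C)
      map_comp := fun {C D E} F G => HomGradedFunctor.degOneModFunctor_comp F G (σ C) (σ D) (σ E)
      map₂_whisker_left := fun {C D E} F G G' η => HModFunctor.hom_ext fun X =>
        (eq_of_heq (HModFunctor.eqToHom_conj_app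
          (HomGradedFunctor.degOneModFunctor_comp F G (σ C) (σ D) (σ E))
          (HomGradedFunctor.degOneModFunctor_comp F G' (σ C) (σ D) (σ E)).symm
          (HModFunctor.whiskerLeft (HomGradedFunctor.degOneModFunctor F (σ C) (σ D))
            (HomGradedFunctor.degOneModNatTrans (σ D) (σ E) η)) X)).symm
      map₂_whisker_right := fun {C D E} F F' η G => HModFunctor.hom_ext fun X =>
        (eq_of_heq (HModFunctor.eqToHom_conj_app
          (HomGradedFunctor.degOneModFunctor_comp F G (σ C) (σ D) (σ E))
          (HomGradedFunctor.degOneModFunctor_comp F' G (σ C) (σ D) (σ E)).symm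
          (HModFunctor.whiskerRight (HomGradedFunctor.degOneModNatTrans (σ C) (σ D) η)
            (HomGradedFunctor.degOneModFunctor G (σ D) (σ E))) X)).symm }

end DegreeOne

section Bullet

variable {R : Type uR} [CommRing R] {H : Type uH} [Group H]

namespace HModCat

variable (M : HModCat.{v, u} R H)

theorem unit_inv_act (h : H) (X : M.Obj) :
    M.unit.inv.app ((M.act h).obj X) = (M.mul (one_mul h)).hom.app X := by
  rw [← cancel_epi (M.unit.hom.app ((M.act h).obj X)), M.unit_mul h X]
  exact M.unit.hom_inv_id_app _

theorem map_unit_inv (h : H) (X : M.Obj) :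
    (M.act h).map (M.unit.inv.app X) = (M.mul (mul_one h)).hom.app X := by
  rw [← cancel_epi ((M.act h).map (M.unit.hom.app X)), M.mul_unit h X,
    ← CategoryTheory.Functor.map_comp, M.unit.hom_inv_id_app]
  exact CategoryTheory.Functor.map_id _ _

theorem mul_inv_unit_inv (h : H) (X : M.Obj) :
    (M.mul (one_mul h)).inv.app X ≫ M.unit.inv.app ((M.act h).obj X) = 𝟙 ((M.act h).obj X) := by
  rw [unit_inv_act]
  exact (M.mul (one_mul h)).inv_hom_id_app _

theorem mul_inv_map_unit_inv (h : H) (X : M.Obj) :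
    (M.mul (mul_one h)).inv.app X ≫ (M.act h).map (M.unit.inv.app X) = 𝟙 ((M.act h).obj X) := by
  rw [map_unit_inv]
  exact (M.mul (mul_one h)).inv_hom_id_app _

theorem mul_inv_assoc {a b c ab bc abc : H} (hab : a * b = ab) (hbc : b * c = bc)
    (h₁ : ab * c = abc) (h₂ : a * bc = abc) (X : M.Obj) :
    (M.mul h₁).inv.app X ≫ (M.mul hab).inv.app ((M.act c).obj X) =
      (M.mul h₂).inv.app X ≫ (M.act a).map ((M.mul hbc).inv.app X) := by
  have key := M.mul_assoc hab hbc h₁ h₂ X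
  let e₁ := (M.mul hab).app ((M.act c).obj X) ≪≫ (M.mul h₁).app X
  let e₂ := (M.act a).mapIso ((M.mul hbc).app X) ≪≫ (M.mul h₂).app X
  have h : e₁ = e₂ := Iso.ext key
  exact congrArg Iso.inv h

/-- The composition of `(C, α)^•`: for `f : α b X ⟶ Y` and `g : α a Y ⟶ Z`, it is
`α c X ≅ α a (α b X) ⟶ α a Y ⟶ Z`, where `a * b = c`. -/
def bulletComp {a b c : H} (p : a * b = c) (X Y Z : M.Obj) :
    ((M.act a).obj Y ⟶ Z) →ₗ[R] ((M.act b).obj X ⟶ Y) →ₗ[R] ((M.act c).obj X ⟶ Z) :=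
  LinearMap.mk₂ R (fun g f => (M.mul p).inv.app X ≫ (M.act a).map f ≫ g)
    (fun g g' f => by simp) (fun r g f => by simp)
    (fun g f f' => by simp [Functor.map_add]) (fun r g f => by simp [Functor.map_smul])

theorem bulletComp_apply {a b c : H} (p : a * b = c) {X Y Z : M.Obj}
    (g : (M.act a).obj Y ⟶ Z) (f : (M.act b).obj X ⟶ Y) :
    M.bulletComp p X Y Z g f = (M.mul p).inv.app X ≫ (M.act a).map f ≫ g := rfl

/-- The `H`-Hom-graded category `(C, α)^•` with the objects of `C`, with
`Hom h X Y = (α h X ⟶ Y)`, and with identities `ε⁻¹ : α 1 X ⟶ X`. -/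
abbrev bulletCat : HomGradedCat.{v, u} R H where
  Obj := M.Obj
  Hom h X Y := (M.act h).obj X ⟶ Y
  id X := M.unit.inv.app X
  comp p := M.bulletComp p _ _ _
  id_comp {a X Y} f := by
    have h₁ := M.unit.inv.naturality f
    have h₂ := M.mul_inv_unit_inv a X
    dsimp at h₁
    rw [bulletComp_apply, h₁, reassoc_of% h₂]
  comp_id {a X Y} f := by
    have h₂ := M.mul_inv_map_unit_inv a X
    rw [bulletComp_apply, reassoc_of% h₂]
  assoc {a b c ab bc abc W X Y Z} hab hbc h₁ h₂ f g k := by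
    have h₃ := (M.mul hab).inv.naturality k
    have h₄ := M.mul_inv_assoc hab hbc h₁ h₂ W
    dsimp at h₃
    rw [bulletComp_apply, bulletComp_apply, bulletComp_apply, bulletComp_apply,
      reassoc_of% h₃, reassoc_of% h₄]
    simp

/-- The shift of `X` by `a` in `(C, α)^•` is `α a X`, with the identity of `α a X` as degree `a`
isomorphism. -/
def bulletShift (X : M.Obj) (a : H) : M.bulletCat.Shift X a where
  obj := (M.act a).obj X
  iso :=
    { hom := 𝟙 ((M.act a).obj X)
      inv := (M.mul (inv_mul_cancel a)).hom.app X ≫ M.unit.inv.app X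
      hom_inv_id := by
        rw [bulletComp_apply, CategoryTheory.Functor.map_id]
        erw [Category.id_comp]
        exact (M.mul (inv_mul_cancel a)).inv_hom_id_app_assoc X _
      inv_hom_id := by
        have h₁ := M.mul_assoc (mul_inv_cancel a) (inv_mul_cancel a) (one_mul a) (mul_one a) X
        rw [bulletComp_apply, Category.comp_id, CategoryTheory.Functor.map_comp, map_unit_inv,
          ← h₁]
        exact ((M.mul (mul_inv_cancel a)).inv_hom_id_app_assoc _ _).trans
          (M.unit_inv_act a X).symm }

/-- The `H`-Hom-graded category `(C, α)^•`, as a category with shifts. -/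
abbrev bulletShiftCat : HomGradedShiftCat.{v, u} R H where
  toHomGradedCat := M.bulletCat
  hasShifts X a := ⟨M.bulletShift X a⟩

end HModCat

namespace HModFunctor

variable {C D E : HModCat.{v, u} R H}

theorem s_one_map_unit_inv (F : HModFunctor C D) (X : C.Obj) :
    (F.s 1).hom.app X ≫ F.functor.map (C.unit.inv.app X) = D.unit.inv.app (F.functor.obj X) := by
  rw [← cancel_epi (D.unit.hom.app (F.functor.obj X)), reassoc_of% (F.s_unit X),
    ← CategoryTheory.Functor.map_comp, C.unit.hom_inv_id_app]
  exact (CategoryTheory.Functor.map_id _ _).trans (D.unit.hom_inv_id_app _).symm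

theorem s_map_mul_inv (F : HModFunctor C D) {a b c : H} (p : a * b = c) (X : C.Obj) :
    (F.s c).hom.app X ≫ F.functor.map ((C.mul p).inv.app X) =
      (D.mul p).inv.app (F.functor.obj X) ≫ (D.act a).map ((F.s b).hom.app X) ≫
        (F.s a).hom.app ((C.act b).obj X) := by
  rw [← cancel_epi ((D.mul p).hom.app (F.functor.obj X)), ← reassoc_of% (F.s_mul p X),
    ← CategoryTheory.Functor.map_comp, (C.mul p).hom_inv_id_app,
    (D.mul p).hom_inv_id_app_assoc]
  erw [CategoryTheory.Functor.map_id, Category.comp_id]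

/-- The Hom-graded functor `(F, s)^•`, sending `f : α h X ⟶ Y` to
`F f ∘ s h X : β h (F X) ⟶ F Y`. -/
abbrev bulletFunctor (F : HModFunctor C D) : HomGradedFunctor C.bulletCat D.bulletCat where
  obj X := F.functor.obj X
  map {a X Y} :=
    { toFun := fun f => (F.s a).hom.app X ≫ F.functor.map f
      map_add' := fun f g => by rw [Functor.map_add, Preadditive.comp_add]
      map_smul' := fun r f => by rw [Functor.map_smul, Linear.comp_smul]; rfl }
  map_id X := F.s_one_map_unit_inv X
  map_comp {a b c X Y Z} p g f := by
    have h₁ := F.s_map_mul_inv p X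
    have h₂ := (F.s a).hom.naturality f
    dsimp at h₂
    change (F.s c).hom.app X ≫ F.functor.map (C.bulletComp p _ _ _ g f) =
      D.bulletComp p _ _ _ ((F.s a).hom.app Y ≫ F.functor.map g)
        ((F.s b).hom.app X ≫ F.functor.map f)
    rw [HModCat.bulletComp_apply, HModCat.bulletComp_apply]
    simp only [CategoryTheory.Functor.map_comp, Category.assoc]
    rw [reassoc_of% h₁, reassoc_of% h₂]

/-- The Hom-graded natural transformation `η^•`, with components
`η_X ∘ ε⁻¹ : β 1 (E X) ⟶ F X`. -/
abbrev bulletNatTrans {F G : HModFunctor C D} (η : F ⟶ G) : F.bulletFunctor ⟶ G.bulletFunctor :=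
  HomGradedNatTrans.mk (F := F.bulletFunctor) (G := G.bulletFunctor)
    (fun X => D.unit.inv.app (F.functor.obj X) ≫ η.natTrans.app X)
    (fun {a X Y} f => by
      have h₁ := D.mul_inv_map_unit_inv a (F.functor.obj X)
      have h₂ := D.mul_inv_unit_inv a (F.functor.obj X)
      have h₃ := D.unit.inv.naturality ((F.s a).hom.app X ≫ F.functor.map f)
      have h₄ := η.natTrans.naturality f
      have h₅ := η.comm a X
      dsimp only [Functor.id_map] at h₃
      change D.bulletComp _ _ _ _ ((G.s a).hom.app X ≫ G.functor.map f)
          (D.unit.inv.app (F.functor.obj X) ≫ η.natTrans.app X) =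
        D.bulletComp _ _ _ _ (D.unit.inv.app (F.functor.obj Y) ≫ η.natTrans.app Y)
          ((F.s a).hom.app X ≫ F.functor.map f)
      rw [HModCat.bulletComp_apply, HModCat.bulletComp_apply, reassoc_of% h₃,
        CategoryTheory.Functor.map_comp, Category.assoc, reassoc_of% h₁, ← reassoc_of% h₅]
      erw [reassoc_of% h₂]
      rw [h₄])

end HModFunctor

namespace HModFunctor

variable {C D E : HModCat.{v, u} R H}

theorem bulletFunctor_id (C : HModCat.{v, u} R H) :
    (HModFunctor.id C).bulletFunctor = HomGradedFunctor.id C.bulletCat :=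
  HomGradedFunctor.ext_of_obj rfl fun _ _ _ f => heq_of_eq (Category.id_comp f)

theorem bulletFunctor_comp (F : HModFunctor C D) (G : HModFunctor D E) :
    (F.comp G).bulletFunctor = F.bulletFunctor.comp G.bulletFunctor :=
  HomGradedFunctor.ext_of_obj rfl fun a X Y f => heq_of_eq (by
    change ((G.s a).hom.app (F.functor.obj X) ≫ G.functor.map ((F.s a).hom.app X)) ≫
      G.functor.map (F.functor.map f) = (G.s a).hom.app (F.functor.obj X) ≫
        G.functor.map ((F.s a).hom.app X ≫ F.functor.map f)
    rw [CategoryTheory.Functor.map_comp, Category.assoc])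

theorem bulletNatTrans_id (F : HModFunctor C D) : bulletNatTrans (𝟙 F) = 𝟙 F.bulletFunctor :=
  HomGradedFunctor.hom_ext fun X => Category.comp_id _

theorem bulletNatTrans_comp {F G K : HModFunctor C D} (η : F ⟶ G) (θ : G ⟶ K) :
    bulletNatTrans (η ≫ θ) = bulletNatTrans η ≫ bulletNatTrans θ :=
  HomGradedFunctor.hom_ext fun X => by
    have h₂ := D.mul_inv_unit_inv 1 (F.functor.obj X)
    have h₃ := D.unit.inv.naturality (D.unit.inv.app (F.functor.obj X) ≫ η.natTrans.app X)
    dsimp only [Functor.id_map] at h₃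
    change D.unit.inv.app (F.functor.obj X) ≫ η.natTrans.app X ≫ θ.natTrans.app X =
      D.bulletComp _ _ _ _ (D.unit.inv.app (G.functor.obj X) ≫ θ.natTrans.app X)
        (D.unit.inv.app (F.functor.obj X) ≫ η.natTrans.app X)
    rw [HModCat.bulletComp_apply, reassoc_of% h₃]
    erw [reassoc_of% h₂]

theorem bulletNatTrans_whiskerRight {F F' : HModFunctor C D} (η : F ⟶ F') (G : HModFunctor D E)
    (X : C.Obj) : (bulletNatTrans (whiskerRight η G)).app X =
      (HomGradedFunctor.whiskerRight (bulletNatTrans η) G.bulletFunctor).app X := by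
  have h := G.s_one_map_unit_inv (F.functor.obj X)
  change E.unit.inv.app (G.functor.obj (F.functor.obj X)) ≫ G.functor.map (η.natTrans.app X) =
    (G.s 1).hom.app (F.functor.obj X) ≫
      G.functor.map (D.unit.inv.app (F.functor.obj X) ≫ η.natTrans.app X)
  rw [CategoryTheory.Functor.map_comp, reassoc_of% h]

end HModFunctor

/-- The 2-functor `(-)^•` from `H`-module categories to `H`-Hom-graded categories with shifts. -/
def bullet : StrictPseudofunctor (HModCat.{v, u} R H) (HomGradedShiftCat.{v, u} R H) :=
  StrictPseudofunctor.mk''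
    { obj := fun M => M.bulletShiftCat
      map := fun F => HModFunctor.bulletFunctor F
      map₂ := fun η => HModFunctor.bulletNatTrans η
      map₂_id := fun F => HModFunctor.bulletNatTrans_id F
      map₂_comp := fun η θ => HModFunctor.bulletNatTrans_comp η θ
      map_id := fun C => HModFunctor.bulletFunctor_id C
      map_comp := fun F G => HModFunctor.bulletFunctor_comp F G
      map₂_whisker_left := fun {C D E} F G G' η => HomGradedFunctor.hom_ext fun X =>
        (eq_of_heq (HomGradedFunctor.eqToHom_conj_app
          (HModFunctor.bulletFunctor_comp F G) (HModFunctor.bulletFunctor_comp F G').symm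
          (HomGradedFunctor.whiskerLeft (HModFunctor.bulletFunctor F)
            (HModFunctor.bulletNatTrans η)) X)).symm
      map₂_whisker_right := fun {C D E} F F' η G => HomGradedFunctor.hom_ext fun X =>
        (HModFunctor.bulletNatTrans_whiskerRight η G X).trans
        (eq_of_heq (HomGradedFunctor.eqToHom_conj_app
          (HModFunctor.bulletFunctor_comp F G) (HModFunctor.bulletFunctor_comp F' G).symm
          (HomGradedFunctor.whiskerRight (HModFunctor.bulletNatTrans η)
            (HModFunctor.bulletFunctor G)) X)).symm }

end Bullet

section Tau

variable (R : Type uR) [CommRing R] {H : Type uH} [Group H] {G : Type uG} [Group G]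

/-- A `G`-grading `C = ⊞ C_g` of a preadditive category: full replete subcategories `C_g`
(`homog g X` says that `X` lies in `C_g`) such that there are no non-zero morphisms between
objects of different degrees (so that two of the subcategories meet only in zero objects), and
every object is a direct sum of finitely many homogeneous objects of pairwise different degrees.
Zero objects, if there are any, are homogeneous of every degree. -/
structure ObjGrading (G : Type uG) (C : Type u) [Category.{v} C] [Preadditive C] where
  homog : G → C → Prop
  of_iso : ∀ {g : G} {X Y : C}, (X ≅ Y) → homog g X → homog g Y
  of_isZero : ∀ (g : G) {X : C}, IsZero X → homog g X
  hom_eq_zero : ∀ {x y : G} {X Y : C}, homog x X → homog y Y → x ≠ y → ∀ f : X ⟶ Y, f = 0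
  decomp : ∀ X : C, ∃ (S : Finset G) (Y : S → C), (∀ g : S, homog g (Y g)) ∧
    ∃ b : Bicone Y, Nonempty b.IsBilimit ∧ Nonempty (b.pt ≅ X)

/-- A `τ`-graded category: an `H`-Hom-graded category `C` with a `G`-grading of `C¹` such that
`Hom h X Y = 0` for `X` of degree `x` and `Y` of degree `y` unless `y = τ h * x`. -/
structure TauGradedCat (τ : H →* G) extends HomGradedCat.{v, u} R H where
  grading : ObjGrading G toHomGradedCat.DegOne
  hom_eq_zero : ∀ {x y : G} {X Y : Obj}, grading.homog x ⟨X⟩ → grading.homog y ⟨Y⟩ →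
    ∀ h : H, y ≠ τ h * x → ∀ f : Hom h X Y, f = 0

/-- A `τ`-graded category with shifts. -/
structure TauGradedShiftCat (τ : H →* G) extends TauGradedCat.{v, u} R τ where
  hasShifts : toHomGradedCat.HasShifts

/-- A `τ`-module category: an `H`-module category with a `G`-grading such that `act h` sends
objects of degree `g` to objects of degree `τ h * g`. -/
structure TauModCat (τ : H →* G) extends HModCat.{v, u} R H where
  grading : ObjGrading G Obj
  act_homog : ∀ (h : H) {g : G} {X : Obj}, grading.homog g X →
    grading.homog (τ h * g) ((act h).obj X)

variable {R} {τ : H →* G}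

/-- A `τ`-graded functor: an `H`-Hom-graded functor that preserves the degrees of homogeneous
objects. -/
structure TauGradedFunctor (C D : TauGradedCat.{v, u} R τ) extends
    HomGradedFunctor C.toHomGradedCat D.toHomGradedCat where
  homog_obj : ∀ {g : G} {X : C.Obj}, C.grading.homog g ⟨X⟩ → D.grading.homog g ⟨obj X⟩

/-- A `τ`-module functor: an `H`-module functor that preserves the degrees of homogeneous
objects. -/
structure TauModFunctor (C D : TauModCat.{v, u} R τ) extends
    HModFunctor C.toHModCat D.toHModCat where
  homog_obj : ∀ {g : G} {X : C.Obj}, C.grading.homog g X → D.grading.homog g (functor.obj X)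

/-- Composition of `τ`-graded functors. -/
abbrev TauGradedFunctor.comp {C D E : TauGradedCat.{v, u} R τ} (F : TauGradedFunctor C D)
    (K : TauGradedFunctor D E) : TauGradedFunctor C E where
  toHomGradedFunctor := HomGradedFunctor.comp F.toHomGradedFunctor K.toHomGradedFunctor
  homog_obj h := K.homog_obj (F.homog_obj h)

/-- Composition of `τ`-module functors. -/
abbrev TauModFunctor.comp {C D E : TauModCat.{v, u} R τ} (F : TauModFunctor C D)
    (K : TauModFunctor D E) : TauModFunctor C E where
  toHModFunctor := HModFunctor.comp F.toHModFunctor K.toHModFunctor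
  homog_obj h := K.homog_obj (F.homog_obj h)

/-- Forget the degrees of objects. -/
abbrev TauGradedShiftCat.toHomGradedShiftCat (C : TauGradedShiftCat.{v, u} R τ) :
    HomGradedShiftCat.{v, u} R H where
  toHomGradedCat := C.toHomGradedCat
  hasShifts := C.hasShifts

/-- `τ`-graded natural transformations are the `H`-Hom-graded natural transformations between
`τ`-graded functors. -/
instance (C D : TauGradedCat.{v, u} R τ) : Category (TauGradedFunctor C D) where
  Hom F G := F.toHomGradedFunctor ⟶ G.toHomGradedFunctor
  id F := 𝟙 F.toHomGradedFunctor
  comp η θ := CategoryStruct.comp (obj := HomGradedFunctor _ _) η θ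
  id_comp η := Category.id_comp (obj := HomGradedFunctor _ _) η
  comp_id η := Category.comp_id (obj := HomGradedFunctor _ _) η
  assoc η θ κ := Category.assoc (obj := HomGradedFunctor _ _) η θ κ

/-- `τ`-module natural transformations are the `H`-module natural transformations between
`τ`-module functors. -/
instance (C D : TauModCat.{v, u} R τ) : Category (TauModFunctor C D) where
  Hom F G := F.toHModFunctor ⟶ G.toHModFunctor
  id F := 𝟙 F.toHModFunctor
  comp η θ := CategoryStruct.comp (obj := HModFunctor _ _) η θ
  id_comp η := Category.id_comp (obj := HModFunctor _ _) η
  comp_id η := Category.comp_id (obj := HModFunctor _ _) η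
  assoc η θ κ := Category.assoc (obj := HModFunctor _ _) η θ κ

theorem TauGradedFunctor.ext' {C D : TauGradedCat.{v, u} R τ} {F G : TauGradedFunctor C D}
    (h : F.toHomGradedFunctor = G.toHomGradedFunctor) : F = G := by
  obtain ⟨F, _⟩ := F
  obtain ⟨G, _⟩ := G
  obtain rfl : F = G := h
  rfl

theorem TauModFunctor.ext' {C D : TauModCat.{v, u} R τ} {F G : TauModFunctor C D}
    (h : F.toHModFunctor = G.toHModFunctor) : F = G := by
  obtain ⟨F, _⟩ := F
  obtain ⟨G, _⟩ := G
  obtain rfl : F = G := h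
  rfl

/-- An isomorphism of `H`-Hom-graded functors is an isomorphism of `τ`-graded functors. -/
def TauGradedFunctor.isoMk {C D : TauGradedCat.{v, u} R τ} {F G : TauGradedFunctor C D}
    (e : F.toHomGradedFunctor ≅ G.toHomGradedFunctor) : F ≅ G where
  hom := e.hom
  inv := e.inv
  hom_inv_id := e.hom_inv_id
  inv_hom_id := e.inv_hom_id

/-- An isomorphism of `H`-module functors is an isomorphism of `τ`-module functors. -/
def TauModFunctor.isoMk {C D : TauModCat.{v, u} R τ} {F G : TauModFunctor C D}
    (e : F.toHModFunctor ≅ G.toHModFunctor) : F ≅ G where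
  hom := e.hom
  inv := e.inv
  hom_inv_id := e.hom_inv_id
  inv_hom_id := e.inv_hom_id

open Bicategory

/-- The 2-category `Cat_τ^{⟨⟩}` of `τ`-graded categories with shifts, `τ`-graded functors and
`τ`-graded natural transformations. -/
instance : Bicategory (TauGradedShiftCat.{v, u} R τ) where
  Hom C D := TauGradedFunctor C.toTauGradedCat D.toTauGradedCat
  id C := ⟨HomGradedFunctor.id C.toHomGradedCat, fun h => h⟩
  comp F K := TauGradedFunctor.comp F K
  homCategory C D := inferInstance
  whiskerLeft F _ _ η := HomGradedFunctor.whiskerLeft F.toHomGradedFunctor η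
  whiskerRight η K := HomGradedFunctor.whiskerRight η K.toHomGradedFunctor
  associator {A B C D} F K L := TauGradedFunctor.isoMk (associator (B := HomGradedShiftCat R H)
    (a := A.toHomGradedShiftCat) (b := B.toHomGradedShiftCat) (c := C.toHomGradedShiftCat)
    (d := D.toHomGradedShiftCat)
    F.toHomGradedFunctor K.toHomGradedFunctor L.toHomGradedFunctor)
  leftUnitor {A B} F := TauGradedFunctor.isoMk (leftUnitor (B := HomGradedShiftCat R H)
    (a := A.toHomGradedShiftCat) (b := B.toHomGradedShiftCat) F.toHomGradedFunctor)
  rightUnitor {A B} F := TauGradedFunctor.isoMk (rightUnitor (B := HomGradedShiftCat R H)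
    (a := A.toHomGradedShiftCat) (b := B.toHomGradedShiftCat) F.toHomGradedFunctor)
  whiskerLeft_id {A B C} F K := whiskerLeft_id (B := HomGradedShiftCat R H)
    (a := A.toHomGradedShiftCat) (b := B.toHomGradedShiftCat) (c := C.toHomGradedShiftCat)
    F.toHomGradedFunctor K.toHomGradedFunctor
  whiskerLeft_comp {A B C} F _ _ _ η θ := whiskerLeft_comp (B := HomGradedShiftCat R H)
    (a := A.toHomGradedShiftCat) (b := B.toHomGradedShiftCat) (c := C.toHomGradedShiftCat)
    F.toHomGradedFunctor η θ
  id_whiskerLeft {A B _ _} η := id_whiskerLeft (B := HomGradedShiftCat R H)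
    (a := A.toHomGradedShiftCat) (b := B.toHomGradedShiftCat) η
  comp_whiskerLeft {A B C D} F K _ _ η := comp_whiskerLeft (B := HomGradedShiftCat R H)
    (a := A.toHomGradedShiftCat) (b := B.toHomGradedShiftCat) (c := C.toHomGradedShiftCat)
    (d := D.toHomGradedShiftCat) F.toHomGradedFunctor K.toHomGradedFunctor η
  id_whiskerRight {A B C} F K := id_whiskerRight (B := HomGradedShiftCat R H)
    (a := A.toHomGradedShiftCat) (b := B.toHomGradedShiftCat) (c := C.toHomGradedShiftCat)
    F.toHomGradedFunctor K.toHomGradedFunctor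
  comp_whiskerRight {A B C _ _ _} η θ K := comp_whiskerRight (B := HomGradedShiftCat R H)
    (a := A.toHomGradedShiftCat) (b := B.toHomGradedShiftCat) (c := C.toHomGradedShiftCat)
    η θ K.toHomGradedFunctor
  whiskerRight_id {A B _ _} η := whiskerRight_id (B := HomGradedShiftCat R H)
    (a := A.toHomGradedShiftCat) (b := B.toHomGradedShiftCat) η
  whiskerRight_comp {A B C D _ _} η K L := whiskerRight_comp (B := HomGradedShiftCat R H)
    (a := A.toHomGradedShiftCat) (b := B.toHomGradedShiftCat) (c := C.toHomGradedShiftCat)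
    (d := D.toHomGradedShiftCat) η K.toHomGradedFunctor L.toHomGradedFunctor
  whisker_assoc {A B C D} F _ _ η L := whisker_assoc (B := HomGradedShiftCat R H)
    (a := A.toHomGradedShiftCat) (b := B.toHomGradedShiftCat) (c := C.toHomGradedShiftCat)
    (d := D.toHomGradedShiftCat) F.toHomGradedFunctor η L.toHomGradedFunctor
  whisker_exchange {A B C _ _ _ _} η θ := whisker_exchange (B := HomGradedShiftCat R H)
    (a := A.toHomGradedShiftCat) (b := B.toHomGradedShiftCat) (c := C.toHomGradedShiftCat) η θ
  pentagon {A B C D E} F K L M := pentagon (B := HomGradedShiftCat R H)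
    (a := A.toHomGradedShiftCat) (b := B.toHomGradedShiftCat) (c := C.toHomGradedShiftCat)
    (d := D.toHomGradedShiftCat) (e := E.toHomGradedShiftCat) F.toHomGradedFunctor
    K.toHomGradedFunctor L.toHomGradedFunctor M.toHomGradedFunctor
  triangle {A B C} F K := triangle (B := HomGradedShiftCat R H)
    (a := A.toHomGradedShiftCat) (b := B.toHomGradedShiftCat) (c := C.toHomGradedShiftCat)
    F.toHomGradedFunctor K.toHomGradedFunctor

instance : Bicategory.Strict (TauGradedShiftCat.{v, u} R τ) where
  id_comp _ := rfl
  comp_id _ := rfl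
  assoc _ _ _ := rfl
  leftUnitor_eqToIso _ := rfl
  rightUnitor_eqToIso _ := rfl
  associator_eqToIso _ _ _ := rfl

/-- The 2-category of `τ`-module categories, `τ`-module functors and `τ`-module natural
transformations. -/
instance : Bicategory (TauModCat.{v, u} R τ) where
  Hom C D := TauModFunctor C D
  id C := ⟨HModFunctor.id C.toHModCat, fun h => h⟩
  comp F K := TauModFunctor.comp F K
  homCategory C D := inferInstance
  whiskerLeft F _ _ η := HModFunctor.whiskerLeft F.toHModFunctor η
  whiskerRight η K := HModFunctor.whiskerRight η K.toHModFunctor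
  associator {A B C D} F K L := TauModFunctor.isoMk (associator (B := HModCat R H)
    (a := A.toHModCat) (b := B.toHModCat) (c := C.toHModCat) (d := D.toHModCat)
    F.toHModFunctor K.toHModFunctor L.toHModFunctor)
  leftUnitor {A B} F := TauModFunctor.isoMk (leftUnitor (B := HModCat R H)
    (a := A.toHModCat) (b := B.toHModCat) F.toHModFunctor)
  rightUnitor {A B} F := TauModFunctor.isoMk (rightUnitor (B := HModCat R H)
    (a := A.toHModCat) (b := B.toHModCat) F.toHModFunctor)
  whiskerLeft_id {A B C} F K := whiskerLeft_id (B := HModCat R H)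
    (a := A.toHModCat) (b := B.toHModCat) (c := C.toHModCat) F.toHModFunctor K.toHModFunctor
  whiskerLeft_comp {A B C} F _ _ _ η θ := whiskerLeft_comp (B := HModCat R H)
    (a := A.toHModCat) (b := B.toHModCat) (c := C.toHModCat) F.toHModFunctor η θ
  id_whiskerLeft {A B _ _} η := id_whiskerLeft (B := HModCat R H)
    (a := A.toHModCat) (b := B.toHModCat) η
  comp_whiskerLeft {A B C D} F K _ _ η := comp_whiskerLeft (B := HModCat R H)
    (a := A.toHModCat) (b := B.toHModCat) (c := C.toHModCat) (d := D.toHModCat)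
    F.toHModFunctor K.toHModFunctor η
  id_whiskerRight {A B C} F K := id_whiskerRight (B := HModCat R H)
    (a := A.toHModCat) (b := B.toHModCat) (c := C.toHModCat) F.toHModFunctor K.toHModFunctor
  comp_whiskerRight {A B C _ _ _} η θ K := comp_whiskerRight (B := HModCat R H)
    (a := A.toHModCat) (b := B.toHModCat) (c := C.toHModCat) η θ K.toHModFunctor
  whiskerRight_id {A B _ _} η := whiskerRight_id (B := HModCat R H)
    (a := A.toHModCat) (b := B.toHModCat) η
  whiskerRight_comp {A B C D _ _} η K L := whiskerRight_comp (B := HModCat R H)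
    (a := A.toHModCat) (b := B.toHModCat) (c := C.toHModCat) (d := D.toHModCat)
    η K.toHModFunctor L.toHModFunctor
  whisker_assoc {A B C D} F _ _ η L := whisker_assoc (B := HModCat R H)
    (a := A.toHModCat) (b := B.toHModCat) (c := C.toHModCat) (d := D.toHModCat)
    F.toHModFunctor η L.toHModFunctor
  whisker_exchange {A B C _ _ _ _} η θ := whisker_exchange (B := HModCat R H)
    (a := A.toHModCat) (b := B.toHModCat) (c := C.toHModCat) η θ
  pentagon {A B C D E} F K L M := pentagon (B := HModCat R H)
    (a := A.toHModCat) (b := B.toHModCat) (c := C.toHModCat) (d := D.toHModCat)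
    (e := E.toHModCat) F.toHModFunctor K.toHModFunctor L.toHModFunctor M.toHModFunctor
  triangle {A B C} F K := triangle (B := HModCat R H)
    (a := A.toHModCat) (b := B.toHModCat) (c := C.toHModCat) F.toHModFunctor K.toHModFunctor

theorem TauModFunctor.eqToHom_app {C D : TauModCat.{v, u} R τ} {F K : TauModFunctor C D}
    (h : F = K) (X : C.Obj) :
    (HModNatTrans.natTrans (F := F.toHModFunctor) (G := K.toHModFunctor) (eqToHom h)).app X ≍
      𝟙 (F.functor.obj X) := by
  subst h; rfl

theorem TauModFunctor.eqToHom_conj {C D : TauModCat.{v, u} R τ}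
    {F F' K' K : TauModFunctor C D} (h : F = F') (h' : K' = K) (η : F' ⟶ K') (X : C.Obj) :
    (HModNatTrans.natTrans (F := F.toHModFunctor) (G := K.toHModFunctor)
      (eqToHom h ≫ η ≫ eqToHom h')).app X ≍
    (HModNatTrans.natTrans (F := F'.toHModFunctor) (G := K'.toHModFunctor) η).app X := by
  subst h h'
  rw [eqToHom_refl, eqToHom_refl, Category.comp_id, Category.id_comp]

theorem TauGradedFunctor.eqToHom_conj {C D : TauGradedCat.{v, u} R τ}
    {F F' K' K : TauGradedFunctor C D} (h : F = F') (h' : K' = K) (η : F' ⟶ K') (X : C.Obj) :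
    HomGradedNatTrans.app (F := F.toHomGradedFunctor) (G := K.toHomGradedFunctor)
      (eqToHom h ≫ η ≫ eqToHom h') X ≍
    HomGradedNatTrans.app (F := F'.toHomGradedFunctor) (G := K'.toHomGradedFunctor) η X := by
  subst h h'
  rw [eqToHom_refl, eqToHom_refl, Category.comp_id, Category.id_comp]

instance : Bicategory.Strict (TauModCat.{v, u} R τ) where
  id_comp F := TauModFunctor.ext' (HModFunctor.id_comp' F.toHModFunctor)
  comp_id F := TauModFunctor.ext' (HModFunctor.comp_id' F.toHModFunctor)
  assoc F K L := TauModFunctor.ext'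
    (HModFunctor.assoc' F.toHModFunctor K.toHModFunctor L.toHModFunctor)
  leftUnitor_eqToIso {A B} F := Iso.ext (HModFunctor.hom_ext fun X =>
    (eq_of_heq (TauModFunctor.eqToHom_app (C := A) (D := B) (F := 𝟙 A ≫ F) (K := F)
      (TauModFunctor.ext' (HModFunctor.id_comp' F.toHModFunctor)) X)).symm)
  rightUnitor_eqToIso {A B} F := Iso.ext (HModFunctor.hom_ext fun X =>
    (eq_of_heq (TauModFunctor.eqToHom_app (C := A) (D := B) (F := F ≫ 𝟙 B) (K := F)
      (TauModFunctor.ext' (HModFunctor.comp_id' F.toHModFunctor)) X)).symm)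
  associator_eqToIso {A B C D} F K L := Iso.ext (HModFunctor.hom_ext fun X =>
    (eq_of_heq (TauModFunctor.eqToHom_app (C := A) (D := D)
      (F := (F ≫ K) ≫ L) (K := F ≫ K ≫ L)
      (TauModFunctor.ext'
      (HModFunctor.assoc' F.toHModFunctor K.toHModFunctor L.toHModFunctor)) X)).symm)

theorem HomGradedCat.DegIso.eq_zero {C : HomGradedCat.{v, u} R H} {a : H} {X Y Z : C.Obj}
    (r : C.DegIso a X Y) (f : C.Hom 1 Y Z) (h : C.comp (one_mul a) f r.hom = 0) : f = 0 := by
  have h₁ := C.assoc (one_mul a) (mul_inv_cancel a) (mul_inv_cancel a) (one_mul 1) f r.hom r.inv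
  rw [h, r.inv_hom_id, C.comp_id, map_zero, LinearMap.zero_apply] at h₁
  exact h₁.symm

/-- A shift by `a` of an object of degree `x` has degree `τ a * x`. -/
theorem TauGradedCat.homog_of_degIso (C : TauGradedCat.{v, u} R τ) {a : H} {X Y : C.Obj}
    (r : C.DegIso a X Y) {x : G} (hX : C.grading.homog x ⟨X⟩) :
    C.grading.homog (τ a * x) ⟨Y⟩ := by
  classical
  obtain ⟨S, Z, hZ, b, ⟨hb⟩, ⟨e⟩⟩ := C.grading.decomp ⟨Y⟩
  have h₀ : ∀ s : S, (s : G) ≠ τ a * x → b.π s = 0 := by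
    intro s hs
    have h₁ := C.hom_eq_zero hX (hZ s) a hs
      (C.comp (one_mul a) (HomGradedCat.DegOne.unHom (e.inv ≫ b.π s)) r.hom)
    have h₂ : e.inv ≫ b.π s = 0 := r.eq_zero _ h₁
    rw [← cancel_epi e.inv, h₂, comp_zero]
  have htot := IsBilimit.total hb
  by_cases h : ∃ s : S, (s : G) = τ a * x
  · obtain ⟨s, hs⟩ := h
    have h₁ : b.π s ≫ b.ι s = 𝟙 b.pt := by
      rw [← htot, Finset.sum_eq_single s]
      · intro t _ hts
        rw [h₀ t, zero_comp]
        intro ht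
        exact hts (Subtype.ext (ht.trans hs.symm))
      · intro hs
        exact absurd (Finset.mem_univ s) hs
    have e' : Z s ≅ b.pt := ⟨b.ι s, b.π s, bicone_ι_π_self b s, h₁⟩
    exact hs ▸ C.grading.of_iso (e' ≪≫ e) (hZ s)
  · refine C.grading.of_isZero _ (IsZero.of_iso ?_ e.symm)
    rw [IsZero.iff_id_eq_zero, ← htot]
    refine Finset.sum_eq_zero fun s _ => ?_
    rw [h₀ s fun hs => h ⟨s, hs⟩, zero_comp]

/-- The `τ`-module category `(C¹, φ)` of a `τ`-graded category with a choice of shifts; objects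
have the same degrees as in `C`. -/
abbrev TauGradedCat.degOneTauMod (C : TauGradedCat.{v, u} R τ)
    (σ : ∀ (X : C.Obj) (a : H), C.Shift X a) : TauModCat.{v, u} R τ where
  toHModCat := HomGradedCat.degOneMod σ
  grading := C.grading
  act_homog h _ X hX := C.homog_of_degIso (σ X.as h).iso hX

/-- The functor of `τ`-module categories `F¹`. -/
abbrev TauGradedFunctor.degOneTauFunctor {C D : TauGradedCat.{v, u} R τ}
    (F : TauGradedFunctor C D) (σ : ∀ (X : C.Obj) (a : H), C.Shift X a)
    (ρ : ∀ (X : D.Obj) (a : H), D.Shift X a) :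
    TauModFunctor (C.degOneTauMod σ) (D.degOneTauMod ρ) where
  toHModFunctor := HomGradedFunctor.degOneModFunctor F.toHomGradedFunctor σ ρ
  homog_obj h := F.homog_obj h

theorem TauGradedFunctor.degOneTauFunctor_comp {C D E : TauGradedCat.{v, u} R τ}
    (F : TauGradedFunctor C D) (K : TauGradedFunctor D E)
    (σ : ∀ (X : C.Obj) (a : H), C.Shift X a) (ρ : ∀ (X : D.Obj) (a : H), D.Shift X a)
    (π : ∀ (X : E.Obj) (a : H), E.Shift X a) :
    (TauGradedFunctor.comp F K).degOneTauFunctor σ π =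
      TauModFunctor.comp (F.degOneTauFunctor σ ρ) (K.degOneTauFunctor ρ π) :=
  TauModFunctor.ext' (HomGradedFunctor.degOneModFunctor_comp F.toHomGradedFunctor
    K.toHomGradedFunctor σ ρ π)

/-- The 2-functor `(-)¹` from `τ`-graded categories with shifts to `τ`-module categories: it is
the 2-functor `degOne` on the underlying `H`-Hom-graded data, and keeps the degrees of objects. -/
def degOneTau (σ : ShiftChoice.{v, u} R H) (τ : H →* G) :
    StrictPseudofunctor (TauGradedShiftCat.{v, u} R τ) (TauModCat.{v, u} R τ) :=
  StrictPseudofunctor.mk''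
    { obj := fun C => C.degOneTauMod (σ C.toHomGradedShiftCat)
      map := fun {C D} F => TauGradedFunctor.degOneTauFunctor F
        (σ C.toHomGradedShiftCat) (σ D.toHomGradedShiftCat)
      map₂ := fun {C D _ _} η => HomGradedFunctor.degOneModNatTrans
        (σ C.toHomGradedShiftCat) (σ D.toHomGradedShiftCat) η
      map₂_id := fun F => rfl
      map₂_comp := fun η θ => rfl
      map_id := fun C => TauModFunctor.ext'
        (HomGradedFunctor.degOneModFunctor_id (σ C.toHomGradedShiftCat))
      map_comp := fun {C D E} F K => TauGradedFunctor.degOneTauFunctor_comp F K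
        (σ C.toHomGradedShiftCat) (σ D.toHomGradedShiftCat) (σ E.toHomGradedShiftCat)
      map₂_whisker_left := fun {C D E} F K K' η => HModFunctor.hom_ext fun X =>
        (eq_of_heq (TauModFunctor.eqToHom_conj
          (TauGradedFunctor.degOneTauFunctor_comp F K (σ C.toHomGradedShiftCat)
            (σ D.toHomGradedShiftCat) (σ E.toHomGradedShiftCat))
          (TauGradedFunctor.degOneTauFunctor_comp F K' (σ C.toHomGradedShiftCat)
            (σ D.toHomGradedShiftCat) (σ E.toHomGradedShiftCat)).symm
          (HModFunctor.whiskerLeft (HomGradedFunctor.degOneModFunctor F.toHomGradedFunctor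
            (σ C.toHomGradedShiftCat) (σ D.toHomGradedShiftCat))
            (HomGradedFunctor.degOneModNatTrans (σ D.toHomGradedShiftCat)
            (σ E.toHomGradedShiftCat) η)) X)).symm
      map₂_whisker_right := fun {C D E F F'} η K => HModFunctor.hom_ext fun X =>
        (eq_of_heq (TauModFunctor.eqToHom_conj
          (TauGradedFunctor.degOneTauFunctor_comp F K (σ C.toHomGradedShiftCat)
            (σ D.toHomGradedShiftCat) (σ E.toHomGradedShiftCat))
          (TauGradedFunctor.degOneTauFunctor_comp F' K (σ C.toHomGradedShiftCat)
            (σ D.toHomGradedShiftCat) (σ E.toHomGradedShiftCat)).symm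
          (HModFunctor.whiskerRight (HomGradedFunctor.degOneModNatTrans
            (σ C.toHomGradedShiftCat) (σ D.toHomGradedShiftCat) η)
            (HomGradedFunctor.degOneModFunctor K.toHomGradedFunctor
            (σ D.toHomGradedShiftCat) (σ E.toHomGradedShiftCat))) X)).symm }

/-- The isomorphism of categories from `C` to `((C, α)^•)¹` which is the identity on objects and
sends `f : X ⟶ Y` to `f ∘ ε⁻¹ : α 1 X ⟶ Y`. -/
abbrev HModCat.toBulletDegOne (M : HModCat.{v, u} R H) : M.Obj ⥤ M.bulletCat.DegOne where
  obj X := ⟨X⟩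
  map {X Y} f := HomGradedCat.DegOne.mkHom (M.unit.inv.app X ≫ f)
  map_id X := Category.comp_id (M.unit.inv.app X)
  map_comp {X Y Z} f g := by
    have h₂ := M.mul_inv_unit_inv 1 X
    have h₃ := M.unit.inv.naturality (M.unit.inv.app X ≫ f)
    dsimp only [Functor.id_map] at h₃
    change M.unit.inv.app X ≫ f ≫ g = M.bulletComp (one_mul 1) _ _ _
      (M.unit.inv.app Y ≫ g) (M.unit.inv.app X ≫ f)
    rw [HModCat.bulletComp_apply, reassoc_of% h₃]
    erw [reassoc_of% h₂]

instance (M : HModCat.{v, u} R H) : M.toBulletDegOne.Additive where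
  map_add {X Y f g} := Preadditive.comp_add _ _ _ (M.unit.inv.app X) f g

instance (M : HModCat.{v, u} R H) : M.toBulletDegOne.Faithful where
  map_injective {X Y f g} h := by
    have h' : M.unit.inv.app X ≫ f = M.unit.inv.app X ≫ g := h
    exact (cancel_epi _).1 h'

instance (M : HModCat.{v, u} R H) : M.toBulletDegOne.Full where
  map_surjective {X Y} f := ⟨M.unit.hom.app X ≫ HomGradedCat.DegOne.unHom f,
    M.unit.inv_hom_id_app_assoc X (HomGradedCat.DegOne.unHom f)⟩

theorem TauModCat.bullet_hom_eq_zero (M : TauModCat.{v, u} R τ) {x y : G} {X Y : M.Obj}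
    (hX : M.grading.homog x X) (hY : M.grading.homog y Y) (h : H) (hxy : y ≠ τ h * x)
    (f : (M.act h).obj X ⟶ Y) : f = 0 :=
  M.grading.hom_eq_zero (M.act_homog h hX) hY (Ne.symm hxy) f

/-- The `τ`-graded category `(C, α)^•` of a `τ`-module category; objects have the same degrees
as in `C`. -/
abbrev TauModCat.bulletTauGraded (M : TauModCat.{v, u} R τ) : TauGradedShiftCat.{v, u} R τ where
  toHomGradedCat := M.toHModCat.bulletCat
  hasShifts := M.toHModCat.bulletShiftCat.hasShifts
  grading :=
    { homog := fun g X => M.grading.homog g X.as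
      of_iso := fun {g X Y} e h => M.grading.of_iso
        (M.toHModCat.toBulletDegOne.preimageIso (X := X.as) (Y := Y.as) e) h
      of_isZero := fun g {X} h => M.grading.of_isZero g ((IsZero.iff_id_eq_zero _).2
        (M.toHModCat.toBulletDegOne.map_injective (by
          rw [CategoryTheory.Functor.map_id, CategoryTheory.Functor.map_zero]
          exact (IsZero.iff_id_eq_zero X).1 h)))
      hom_eq_zero := fun {x y X Y} hX hY hxy f => M.bullet_hom_eq_zero hX hY 1
        (by rw [map_one, one_mul]; exact hxy.symm) (HomGradedCat.DegOne.unHom f)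
      decomp := fun X => by
        classical
        obtain ⟨S, Y, hY, b, ⟨hb⟩, ⟨e⟩⟩ := M.grading.decomp X.as
        have h₁ := congrArg M.toHModCat.toBulletDegOne.map (IsBilimit.total hb)
        rw [CategoryTheory.Functor.map_sum, CategoryTheory.Functor.map_id] at h₁
        exact ⟨S, fun s => ⟨Y s⟩, hY, M.toHModCat.toBulletDegOne.mapBicone b,
          ⟨isBilimitOfTotal _ ((Finset.sum_congr rfl fun j _ =>
            (M.toHModCat.toBulletDegOne.map_comp (b.π j) (b.ι j)).symm).trans h₁)⟩,
          ⟨M.toHModCat.toBulletDegOne.mapIso e⟩⟩ }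
  hom_eq_zero hX hY h hxy f := M.bullet_hom_eq_zero hX hY h hxy f

/-- The functor of `τ`-graded categories `F^•`. -/
abbrev TauModFunctor.bulletTauFunctor {C D : TauModCat.{v, u} R τ} (F : TauModFunctor C D) :
    TauGradedFunctor C.bulletTauGraded.toTauGradedCat D.bulletTauGraded.toTauGradedCat where
  toHomGradedFunctor := HModFunctor.bulletFunctor F.toHModFunctor
  homog_obj h := F.homog_obj h

theorem TauModFunctor.bulletTauFunctor_comp {C D E : TauModCat.{v, u} R τ}
    (F : TauModFunctor C D) (K : TauModFunctor D E) :
    (TauModFunctor.comp F K).bulletTauFunctor =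
      TauGradedFunctor.comp F.bulletTauFunctor K.bulletTauFunctor :=
  TauGradedFunctor.ext' (HModFunctor.bulletFunctor_comp F.toHModFunctor K.toHModFunctor)

/-- The 2-functor `(-)^•` from `τ`-module categories to `τ`-graded categories with shifts: it is
the 2-functor `bullet` on the underlying `H`-module data, and keeps the degrees of objects. -/
def bulletTau (τ : H →* G) :
    StrictPseudofunctor (TauModCat.{v, u} R τ) (TauGradedShiftCat.{v, u} R τ) :=
  StrictPseudofunctor.mk''
    { obj := fun M => M.bulletTauGraded
      map := fun F => TauModFunctor.bulletTauFunctor F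
      map₂ := fun η => HModFunctor.bulletNatTrans η
      map₂_id := fun F => HModFunctor.bulletNatTrans_id F.toHModFunctor
      map₂_comp := fun η θ => HModFunctor.bulletNatTrans_comp η θ
      map_id := fun C => TauGradedFunctor.ext' (HModFunctor.bulletFunctor_id C.toHModCat)
      map_comp := fun F K => TauModFunctor.bulletTauFunctor_comp F K
      map₂_whisker_left := fun {C D E} F K K' η => HomGradedFunctor.hom_ext fun X =>
        (eq_of_heq (TauGradedFunctor.eqToHom_conj
          (TauModFunctor.bulletTauFunctor_comp F K) (TauModFunctor.bulletTauFunctor_comp F K').symm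
          (HomGradedFunctor.whiskerLeft (HModFunctor.bulletFunctor F.toHModFunctor)
            (HModFunctor.bulletNatTrans η)) X)).symm
      map₂_whisker_right := fun {C D E F F'} η K => HomGradedFunctor.hom_ext fun X =>
        (HModFunctor.bulletNatTrans_whiskerRight η K.toHModFunctor X).trans
        (eq_of_heq (TauGradedFunctor.eqToHom_conj
          (TauModFunctor.bulletTauFunctor_comp F K) (TauModFunctor.bulletTauFunctor_comp F' K).symm
          (HomGradedFunctor.whiskerRight (HModFunctor.bulletNatTrans η)
            (HModFunctor.bulletFunctor K.toHModFunctor)) X)).symm }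

variable (R) in
/-- The 2-functor forgetting the degrees of objects of `τ`-graded categories with shifts. -/
def forgetGraded (τ : H →* G) :
    StrictPseudofunctor (TauGradedShiftCat.{v, u} R τ) (HomGradedShiftCat.{v, u} R H) :=
  StrictPseudofunctor.mk''
    { obj := fun C => C.toHomGradedShiftCat
      map := fun F => F.toHomGradedFunctor
      map₂ := fun η => η
      map_id := fun _ => rfl
      map_comp := fun _ _ => rfl
      map₂_whisker_left := fun F K K' η => by
        rw [eqToHom_refl, eqToHom_refl, Category.comp_id, Category.id_comp]; rfl
      map₂_whisker_right := fun η K => by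
        rw [eqToHom_refl, eqToHom_refl, Category.comp_id, Category.id_comp]; rfl }

variable (R) in
/-- The 2-functor forgetting the degrees of objects of `τ`-module categories. -/
def forgetMod (τ : H →* G) :
    StrictPseudofunctor (TauModCat.{v, u} R τ) (HModCat.{v, u} R H) :=
  StrictPseudofunctor.mk''
    { obj := fun C => C.toHModCat
      map := fun F => F.toHModFunctor
      map₂ := fun η => η
      map_id := fun _ => rfl
      map_comp := fun _ _ => rfl
      map₂_whisker_left := fun F K K' η => by
        rw [eqToHom_refl, eqToHom_refl, Category.comp_id, Category.id_comp]; rfl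
      map₂_whisker_right := fun η K => by
        rw [eqToHom_refl, eqToHom_refl, Category.comp_id, Category.id_comp]; rfl }

end Tau

section TwoEquivalence

open Bicategory

variable {B : Type u₁} [Bicategory.{w₁, v₁} B] {C : Type u₂} [Bicategory.{w₂, v₂} C]

/-- A 2-natural transformation between 2-functors of (strict) 2-categories. -/
structure TwoNatTrans (F F' : StrictPseudofunctor B C) where
  app : ∀ X : B, F.obj X ⟶ F'.obj X
  naturality : ∀ {X Y : B} (f : X ⟶ Y), F.map f ≫ app Y = app X ≫ F'.map f
  naturality₂ : ∀ {X Y : B} {f g : X ⟶ Y} (θ : f ⟶ g),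
    F.map₂ θ ▷ app Y =
      eqToHom (naturality f) ≫ app X ◁ F'.map₂ θ ≫ eqToHom (naturality g).symm

/-- A 2-natural transformation is a 2-natural isomorphism if its components are invertible
1-cells. -/
def TwoNatTrans.IsIso {F F' : StrictPseudofunctor B C} (α : TwoNatTrans F F') : Prop :=
  ∀ X : B, ∃ β : F'.obj X ⟶ F.obj X, α.app X ≫ β = 𝟙 (F.obj X) ∧ β ≫ α.app X = 𝟙 (F'.obj X)

/-- A 2-equivalence of 2-categories with underlying 2-functors `F : B ⟶ C` and `K : C ⟶ B`:
2-natural isomorphisms `ν : F ∘ K ⟶ id` and `η : K ∘ F ⟶ id`. -/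
structure TwoEquivalence (F : StrictPseudofunctor B C) (K : StrictPseudofunctor C B) where
  ν : TwoNatTrans (K.comp F) (StrictPseudofunctor.id C)
  ν_isIso : ν.IsIso
  η : TwoNatTrans (F.comp K) (StrictPseudofunctor.id B)
  η_isIso : η.IsIso

end TwoEquivalence

/-! The theorem rests on one observation. A degree `a` isomorphism `r : X → X⟨a⟩` turns degree `a`
morphisms out of `X` into degree `1` morphisms out of `X⟨a⟩`, so precomposition with `r` identifies
`Hom¹(X⟨a⟩, Y)` with `Hom^a(X, Y)`. The category `C¹` together with its shift action therefore
remembers all of `C`, and `f ↦ f ∘ r_{X,a}` is an isomorphism `(C¹)^• → C`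
(`HomGradedCat.ofDegOneBullet`). It respects composition because the structure maps `μ` of `C¹` are
composites of shifts and their inverses, which telescope (`toHomog_bulletUnHom_comp`).

Conversely, a degree `1` morphism of `(C, α)^•` is a morphism `α^1 X → Y`, and `ε` makes it a
morphism `X → Y`; this gives `((C, α)^•)¹ → C` on morphisms. The chosen shifts of `(C, α)^•` need
not be the objects `α^a X`. However, a shift `r_{X,a}` is by definition a morphism `α^a X → X⟨a⟩` of
`C`, and it is invertible there (`isoOfDegIso`). These isomorphisms compare the action by chosen
shifts with `α`, and they make the functor an `H`-module functor (`ofBulletDegOneMod`).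

All comparison functors are the identity on objects and bijective on morphisms, so they are
invertible on the nose. Their naturality squares commute strictly, because the coherence `F(r_{X,a})
∘ r_{FX,a}⁻¹` of `F¹` cancels against the shift in the comparison functor. Identities between
composites of shifts are checked in `Homog`, where homogeneous morphisms of all degrees form one
category and shifts are ordinary isomorphisms.

A `G`-grading is only a condition on objects, and both 2-functors keep it. The comparison functors
therefore preserve degrees trivially, and every equation in the `τ`-graded setting is the underlying
one. -/

section DegOneBullet

variable {R : Type uR} [CommRing R] {H : Type uH} [Group H]

/-! ### The isomorphism `((C, α)^•)¹ ≅ C` of `H`-module categories -/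

namespace HModCat

open HomGradedCat

variable (M : HModCat.{v, u} R H)

/-- This form of the right unit law lets `α^h(ε ≫ f) ≫ k` be recognised as the composite `k ∘ f` of
`(C, α)^•` for `f` of degree `1`. -/
theorem act_map_unit_hom (h : H) (X : M.Obj) :
    (M.act h).map (M.unit.hom.app X) = (M.mul (mul_one h)).inv.app X := by
  rw [← cancel_mono ((M.mul (mul_one h)).hom.app X), M.mul_unit h X]
  exact ((M.mul (mul_one h)).inv_hom_id_app X).symm

/-- Composition in `(C, α)^•` with a morphism of degree `1` on the left is composition in `C`. -/
theorem bulletComp_one_mul {a : H} {X Y Z : M.Obj} (g : (M.act 1).obj Y ⟶ Z)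
    (k : (M.act a).obj X ⟶ Y) :
    M.bulletComp (one_mul a) X Y Z g k = k ≫ M.unit.hom.app Y ≫ g := by
  have h₁ := M.unit.hom.naturality k
  have h₂ := M.mul_inv_unit_inv a X
  -- By the left unit law `μ_{1,a}⁻¹` is a component of `ε`, so naturality of `ε` moves it past `k`.
  have h₃ : (M.mul (one_mul a)).inv.app X = M.unit.hom.app ((M.act a).obj X) := by
    rw [← cancel_mono (M.unit.inv.app ((M.act a).obj X)), h₂]
    exact (M.unit.hom_inv_id_app _).symm
  dsimp only [Functor.id_map] at h₁
  rw [bulletComp_apply, h₃, reassoc_of% h₁]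

/-- The functor `((C, α)^•)¹ ⟶ C` which is the identity on objects and sends `f : α 1 X ⟶ Y` to
`f ∘ ε : X ⟶ Y`. -/
abbrev ofBulletDegOne : M.bulletCat.DegOne ⥤ M.Obj where
  obj X := X.as
  map {X Y} f := M.unit.hom.app X.as ≫ DegOne.unHom f
  map_id X := M.unit.hom_inv_id_app X.as
  map_comp {X Y Z} f g := by
    change M.unit.hom.app X.as ≫ M.bulletComp (one_mul 1) X.as Y.as Z.as _ _ = _
    rw [bulletComp_one_mul, Category.assoc]
    rfl

instance : M.ofBulletDegOne.Additive where
  map_add {X _ f g} := Preadditive.comp_add _ _ _ (M.unit.hom.app X.as) f g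

instance : M.ofBulletDegOne.Linear R where
  map_smul {X _} f r := Linear.comp_smul _ _ _ (M.unit.hom.app X.as) r f

instance : M.toBulletDegOne.Linear R where
  map_smul {X _} f r := Linear.comp_smul _ _ _ (M.unit.inv.app X) r f

theorem ofBulletDegOne_map_toBulletDegOne_map {X Y : M.Obj} (f : X ⟶ Y) :
    M.ofBulletDegOne.map (M.toBulletDegOne.map f) = f :=
  M.unit.hom_inv_id_app_assoc X f

theorem toBulletDegOne_map_ofBulletDegOne_map {X Y : M.bulletCat.DegOne} (f : X ⟶ Y) :
    M.toBulletDegOne.map (M.ofBulletDegOne.map f) = f :=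
  M.unit.inv_hom_id_app_assoc X.as f

/-- Faithfulness allows equations in `((C, α)^•)¹` to be verified in `C`, where composition involves
neither `μ` nor `ε`. -/
theorem ofBulletDegOne_map_injective {X Y : M.bulletCat.DegOne} {f g : X ⟶ Y}
    (h : M.ofBulletDegOne.map f = M.ofBulletDegOne.map g) : f = g := by
  rw [← M.toBulletDegOne_map_ofBulletDegOne_map f, h, M.toBulletDegOne_map_ofBulletDegOne_map]

/-- The bridge from composites in `C` to composites in `(C, α)^•`; on that side shifts can be
cancelled against their inverses. -/
theorem comp_ofBulletDegOne_map {a : H} {X : M.Obj} {Y Z : M.bulletCat.DegOne}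
    (k : (M.act a).obj X ⟶ Y.as) (g : Y ⟶ Z) :
    k ≫ M.ofBulletDegOne.map g =
      M.bulletCat.comp (one_mul a) (DegOne.unHom g) k :=
  (M.bulletComp_one_mul _ k).symm

/-- A degree `a` isomorphism `X ⟶ Y` of `(C, α)^•` is an isomorphism `α a X ≅ Y` of `C`. -/
def isoOfDegIso {a : H} {X Y : M.Obj} (r : M.bulletCat.DegIso a X Y) : (M.act a).obj X ≅ Y where
  hom := r.hom
  -- The identity of `α^a X` is a morphism `X → α^a X` of degree `a`. Composed with `r⁻¹` it has
  -- degree `1`, and `ε` makes it a morphism `Y → α^a X` of `C`.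
  inv := M.unit.hom.app Y ≫ M.bulletCat.comp (mul_inv_cancel a)
    (Z := (M.act a).obj X) (𝟙 ((M.act a).obj X)) r.inv
  hom_inv_id := by
    -- Composition in `C` is read as composition with a degree `1` morphism of `(C, α)^•`;
    -- associativity there brings `r⁻¹` next to `r`.
    refine (M.bulletComp_one_mul _ _).symm.trans ?_
    refine (M.bulletCat.assoc (mul_inv_cancel a) (inv_mul_cancel a) (one_mul a) (mul_one a)
      (𝟙 ((M.act a).obj X)) r.inv r.hom).trans ?_
    rw [r.hom_inv_id, M.bulletCat.comp_id]
  inv_hom_id := by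
    -- Both sides unfold to `μ⁻¹ ≫ α^a(r⁻¹) ≫ r`, the composite `r ∘ r⁻¹` in `(C, α)^•`, whose value
    -- is the identity `ε⁻¹` of `Y`.
    have h₁ : M.bulletComp (mul_inv_cancel a) Y X _ (𝟙 ((M.act a).obj X)) r.inv ≫ r.hom =
        M.unit.inv.app Y := by
      refine Eq.trans ?_ r.inv_hom_id
      rw [bulletComp_apply, Category.comp_id, Category.assoc]
      rfl
    rw [Category.assoc]
    exact (congrArg (M.unit.hom.app Y ≫ ·) h₁).trans (M.unit.hom_inv_id_app Y)

variable (σ : ∀ (X : M.bulletCat.Obj) (a : H), M.bulletCat.Shift X a)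

/-- In `(C, α)^•` this is the equation `r_Y ∘ f = (r_Y ∘ f ∘ r_X⁻¹) ∘ r_X`, the bracket being the
shift functor applied to `f`. The left side becomes the composite in `C` because `α^h ε = μ⁻¹`, the
right side because the bracket has degree `1`. -/
theorem isoOfDegIso_naturality (h : H) {X Y : M.bulletCat.DegOne} (f : X ⟶ Y) :
    (M.act h).map (M.ofBulletDegOne.map f) ≫ (M.isoOfDegIso (σ Y.as h).iso).hom =
      (M.isoOfDegIso (σ X.as h).iso).hom ≫ M.ofBulletDegOne.map ((shiftFunctor σ h).map f) := by
  refine Eq.trans ?_ (M.comp_ofBulletDegOne_map (σ X.as h).iso.hom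
    ((shiftFunctor σ h).map f)).symm
  have h₁ : M.bulletCat.comp (one_mul h) (DegOne.unHom ((shiftFunctor σ h).map f))
      (σ X.as h).iso.hom = M.bulletCat.comp (mul_one h) (σ Y.as h).iso.hom (DegOne.unHom f) :=
    toHomog_injective (by
      rw [toHomog_comp, toHomog_comp, DegOne.toHomog_unHom, hm_shiftFunctor_map, toHomog_hom,
        toHomog_hom, Iso.hom_inv_id_assoc]
      rfl)
  rw [h₁, CategoryTheory.Functor.map_comp, act_map_unit_hom, Category.assoc]
  rfl

/-- The isomorphism `((C, α)^•)¹ ⟶ C` of `H`-module categories. -/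
abbrev ofBulletDegOneMod : HModFunctor (degOneMod σ) M where
  functor := M.ofBulletDegOne
  -- The coherence is the chosen shift `r_{X,h}` itself, read as a morphism `α^h X → X⟨h⟩` of `C`.
  s h := NatIso.ofComponents (fun X => M.isoOfDegIso (σ X.as h).iso)
    (fun f => M.isoOfDegIso_naturality σ h f)
  -- Both sides are `ε` followed by `r_{X,1}`, since the unit of the shift action is `r_{X,1}` and
  -- the functor prepends `ε`.
  s_unit X := rfl
  s_mul {a b c} p X := by
    change (M.act a).map (M.isoOfDegIso (σ X.as b).iso).hom ≫
      (M.isoOfDegIso (σ (σ X.as b).obj a).iso).hom ≫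
        M.ofBulletDegOne.map (shiftMulApp σ p X).hom =
      (M.mul p).hom.app X.as ≫ (M.isoOfDegIso (σ X.as c).iso).hom
    -- The multiplication of the shift action is `r_{X,c} ∘ r_{X,b}⁻¹ ∘ r_{X⟨b⟩,a}⁻¹`, so it carries
    -- the iterated shift to `r_{X,c}`.
    have h₁ : M.bulletCat.comp p
        (M.bulletCat.comp (one_mul a) (DegOne.unHom (shiftMulApp σ p X).hom)
          (σ (σ X.as b).obj a).iso.hom) (σ X.as b).iso.hom = (σ X.as c).iso.hom :=
      toHomog_injective (by
        rw [toHomog_comp, toHomog_comp, DegOne.toHomog_unHom, hm_shiftMulApp, toHomog_hom,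
          toHomog_hom, toHomog_hom, Iso.hom_inv_id_assoc, Iso.hom_inv_id_assoc])
    have h₂ := M.comp_ofBulletDegOne_map (σ (σ X.as b).obj a).iso.hom (shiftMulApp σ p X).hom
    -- With `μ⁻¹` in front, and the last two factors combined by `h₂`, the left side is the
    -- composite in `h₁`.
    rw [← cancel_epi ((M.mul p).inv.app X.as), (M.mul p).inv_hom_id_app_assoc]
    refine Eq.trans ?_ h₁
    exact congrArg (fun k => (M.mul p).inv.app X.as ≫
      (M.act a).map (M.isoOfDegIso (σ X.as b).iso).hom ≫ k) h₂

theorem ofBulletDegOne_map_comp {X : M.bulletCat.DegOne} {Y Z : M.Obj}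
    (f : X ⟶ M.toBulletDegOne.obj Y) (g : Y ⟶ Z) :
    M.ofBulletDegOne.map (f ≫ M.toBulletDegOne.map g) = M.ofBulletDegOne.map f ≫ g :=
  (M.ofBulletDegOne.map_comp _ _).trans
    (congrArg (M.ofBulletDegOne.map f ≫ ·) (M.ofBulletDegOne_map_toBulletDegOne_map g))

theorem isoOfDegIso_inv_naturality (h : H) {X Y : M.bulletCat.DegOne} (f : X ⟶ Y) :
    M.ofBulletDegOne.map ((shiftFunctor σ h).map f) ≫ (M.isoOfDegIso (σ Y.as h).iso).inv =
      (M.isoOfDegIso (σ X.as h).iso).inv ≫ (M.act h).map (M.ofBulletDegOne.map f) := by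
  rw [Iso.eq_inv_comp, ← Category.assoc, Iso.comp_inv_eq]
  exact (M.isoOfDegIso_naturality σ h f).symm

/-- The isomorphism `C ⟶ ((C, α)^•)¹` of `H`-module categories, inverse to
`HModCat.ofBulletDegOneMod`. -/
abbrev toBulletDegOneMod : HModFunctor M (degOneMod σ) where
  functor := M.toBulletDegOne
  -- The coherence of the inverse must run `X⟨h⟩ → α^h X`; it consists of the inverses of the
  -- previous coherence isomorphisms, carried over to `((C, α)^•)¹`.
  s h := NatIso.ofComponents
    (fun X => M.toBulletDegOne.mapIso (M.isoOfDegIso (σ X h).iso).symm)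
    (fun {X Y} f => M.ofBulletDegOne_map_injective (by
      have h₁ := M.isoOfDegIso_inv_naturality σ h (M.toBulletDegOne.map f)
      rw [ofBulletDegOne_map_toBulletDegOne_map] at h₁
      refine (M.ofBulletDegOne_map_comp _ _).trans (h₁.trans ?_)
      exact ((M.ofBulletDegOne_map_comp _ _).trans (congrArg (· ≫ (M.act h).map f)
        (M.ofBulletDegOne_map_toBulletDegOne_map _))).symm))
  s_unit X := M.ofBulletDegOne_map_injective (by
    refine (M.ofBulletDegOne_map_comp _ _).trans
      (Eq.trans ?_ (M.ofBulletDegOne_map_toBulletDegOne_map _).symm)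
    refine (Iso.comp_inv_eq (M.isoOfDegIso (σ X 1).iso)).2 ?_
    rfl)
  s_mul {a b c} p X := M.ofBulletDegOne_map_injective (by
    -- After passage to `C`, the claim is this known compatibility with every coherence isomorphism
    -- moved to the other side.
    have h₁ := (M.ofBulletDegOneMod σ).s_mul p ⟨X⟩
    -- The goal contains the shift of `α^b X` by `a`, while `h₁` contains the shift of `X⟨b⟩`;
    -- naturality along `X⟨b⟩ ≅ α^b X` exchanges them.
    have h₂ := M.isoOfDegIso_inv_naturality σ a
      (M.toBulletDegOne.map (M.isoOfDegIso (σ X b).iso).inv)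
    rw [ofBulletDegOne_map_toBulletDegOne_map] at h₂
    change (M.act a).map (M.isoOfDegIso (σ X b).iso).hom ≫
      (M.isoOfDegIso (σ (σ X b).obj a).iso).hom ≫
        M.ofBulletDegOne.map (shiftMulApp σ p ⟨X⟩).hom =
      (M.mul p).hom.app X ≫ (M.isoOfDegIso (σ X c).iso).hom at h₁
    refine Eq.trans ?_ (M.ofBulletDegOne_map_comp (shiftMulApp σ p ⟨X⟩).hom
      (M.isoOfDegIso (σ X c).iso).inv).symm
    change M.ofBulletDegOne.map ((shiftFunctor σ a).map
      (M.toBulletDegOne.map (M.isoOfDegIso (σ X b).iso).inv) ≫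
        M.toBulletDegOne.map (M.isoOfDegIso (σ ((M.act b).obj X) a).iso).inv ≫
          M.toBulletDegOne.map ((M.mul p).hom.app X)) = _
    rw [← CategoryTheory.Functor.map_comp M.toBulletDegOne]
    refine (M.ofBulletDegOne_map_comp _ _).trans ?_
    refine (Category.assoc _ _ _).symm.trans ((congrArg (· ≫ _) h₂).trans ?_)
    refine (Iso.eq_comp_inv _).2 ?_
    rw [Category.assoc, Category.assoc, Iso.inv_comp_eq, ← Functor.mapIso_inv, Iso.inv_comp_eq]
    exact h₁.symm)

/-- The composite is strictly the identity, not just isomorphic to it: objects do not change, `ε`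
cancels against `ε⁻¹` on morphisms, and each coherence isomorphism meets its inverse. -/
theorem ofBulletDegOneMod_comp_toBulletDegOneMod :
    (M.ofBulletDegOneMod σ).comp (M.toBulletDegOneMod σ) = HModFunctor.id (degOneMod σ) :=
  HModFunctor.ext_of_functor
    (CategoryTheory.Functor.hext (fun _ => rfl) (fun X Y f => heq_of_eq (by
      exact M.toBulletDegOne_map_ofBulletDegOne_map f)))
    (fun h X => heq_of_eq (by
      change M.toBulletDegOne.map (M.isoOfDegIso (σ X.as h).iso).inv ≫
        M.toBulletDegOne.map (M.isoOfDegIso (σ X.as h).iso).hom = 𝟙 _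
      rw [← CategoryTheory.Functor.map_comp, Iso.inv_hom_id, CategoryTheory.Functor.map_id]))

theorem toBulletDegOneMod_comp_ofBulletDegOneMod :
    (M.toBulletDegOneMod σ).comp (M.ofBulletDegOneMod σ) = HModFunctor.id M :=
  HModFunctor.ext_of_functor
    (CategoryTheory.Functor.hext (fun _ => rfl) (fun X Y f => heq_of_eq (by
      exact M.ofBulletDegOne_map_toBulletDegOne_map f)))
    (fun h X => heq_of_eq (by
      refine (congrArg ((M.isoOfDegIso (σ X h).iso).hom ≫ ·)
        (M.ofBulletDegOne_map_toBulletDegOne_map _)).trans ?_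
      exact Iso.hom_inv_id _))

end HModCat

/-! ### Naturality of `((C, α)^•)¹ ≅ C` in 1-morphisms and 2-morphisms -/

namespace HModFunctor

open HomGradedCat

variable {M N : HModCat.{v, u} R H} (F : HModFunctor M N)
  (σ : ∀ (X : M.bulletCat.Obj) (a : H), M.bulletCat.Shift X a)
  (ρ : ∀ (X : N.bulletCat.Obj) (a : H), N.bulletCat.Shift X a)

/-- On morphisms this is the compatibility of `s` with the units. For the coherences, `(F^•)¹`
contributes `F^•(r_{X,h}) ∘ r_{FX,h}⁻¹` and the comparison functor of `N` contributes `r_{FX,h}`;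
they cancel to `F^•(r_{X,h})`, that is `s^h_X ≫ F(r_{X,h})`, which is the coherence of the other
composite. -/
theorem ofBulletDegOneMod_naturality :
    (F.bulletFunctor.degOneModFunctor σ ρ).comp (N.ofBulletDegOneMod ρ) =
      (M.ofBulletDegOneMod σ).comp F :=
  ext_of_functor
    (CategoryTheory.Functor.hext (fun _ => rfl) (fun X Y f => heq_of_eq (by
      change N.unit.hom.app (F.functor.obj X.as) ≫ (F.s 1).hom.app X.as ≫
        F.functor.map (DegOne.unHom f) = F.functor.map (M.unit.hom.app X.as ≫ DegOne.unHom f)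
      rw [reassoc_of% (F.s_unit X.as), CategoryTheory.Functor.map_comp])))
    (fun h X => heq_of_eq (by
      change (ρ (F.functor.obj X.as) h).iso.hom ≫
        N.ofBulletDegOne.map (F.bulletFunctor.shiftCompApp σ ρ h X).hom =
          F.bulletFunctor.map (σ X.as h).iso.hom
      refine (N.comp_ofBulletDegOne_map (ρ (F.functor.obj X.as) h).iso.hom
        (F.bulletFunctor.shiftCompApp σ ρ h X).hom).trans (toHomog_injective ?_)
      rw [toHomog_comp, DegOne.toHomog_unHom, HomGradedFunctor.hm_shiftCompApp, toHomog_hom,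
        Iso.hom_inv_id_assoc]
      rfl))

/-- The content of 2-naturality on 2-morphisms: `θ^•` has components `ε⁻¹ ≫ θ_X`, and the comparison
functor prepends `ε`. -/
theorem bulletNatTrans_degOneModNatTrans_app {F F' : HModFunctor M N} (θ : F ⟶ F')
    (X : M.bulletCat.DegOne) :
    (whiskerRight (HomGradedFunctor.degOneModNatTrans σ ρ (bulletNatTrans θ))
      (N.ofBulletDegOneMod ρ)).natTrans.app X = θ.natTrans.app X.as :=
  N.unit.hom_inv_id_app_assoc _ (θ.natTrans.app X.as)

end HModFunctor

end DegOneBullet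

/-! ### The isomorphism `(C¹)^• ≅ C` of Hom-graded categories -/

section BulletDegOne

variable {R : Type uR} [CommRing R] {H : Type uH} [Group H]

namespace HomGradedCat

variable (C : HomGradedCat.{v, u} R H) (σ : ∀ (X : C.Obj) (a : H), C.Shift X a)

/-- A morphism of degree `a` of `(C¹)^•`, i.e. a morphism `X⟨a⟩ ⟶ Y` of degree `1` of `C`. -/
def bulletUnHom {a : H} {X Y : C.DegOne} (f : (degOneMod σ).bulletCat.Hom a X Y) :
    C.Hom 1 (σ X.as a).obj Y.as := f

/-- This is functoriality of `f ↦ f ∘ r_{X,a}`, stated in `Homog` to avoid bookkeeping of degrees.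
Since `μ⁻¹` is `r_{X⟨b⟩,a} ∘ r_{X,b} ∘ r_{X,c}⁻¹` and the shift functor conjugates `f` by shifts,
all factors but `r_{X,b}`, `f`, `r_{Y,a}`, `g` cancel. -/
theorem toHomog_bulletUnHom_comp {a b c : H} {X Y Z : C.DegOne} (p : a * b = c)
    (g : (degOneMod σ).bulletCat.Hom a Y Z) (f : (degOneMod σ).bulletCat.Hom b X Y) :
    (σ X.as c).iso.toIso.hom ≫
        toHomog (C.bulletUnHom σ ((degOneMod σ).bulletCat.comp p g f)) =
      ((σ X.as b).iso.toIso.hom ≫ toHomog (C.bulletUnHom σ f)) ≫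
        (σ Y.as a).iso.toIso.hom ≫ toHomog (C.bulletUnHom σ g) := by
  change (σ X.as c).iso.toIso.hom ≫ DegOne.hm ((shiftMulApp σ p X).inv ≫
    (shiftFunctor σ a).map (DegOne.mkHom (C.bulletUnHom σ f)) ≫
      (DegOne.mkHom (C.bulletUnHom σ g))) = _
  have h : DegOne.hm (shiftMulApp σ p X).inv = (σ X.as c).iso.toIso.inv ≫
      (σ X.as b).iso.toIso.hom ≫ (σ (σ X.as b).obj a).iso.toIso.hom := by
    simp only [shiftMulApp, DegOne.mkIso, DegOne.hm_mk, toHomog_comp, toHomog_inv, toHomog_hom]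
  rw [DegOne.hm_comp, DegOne.hm_comp, hm_shiftFunctor_map, h]
  simp only [Category.assoc, Iso.hom_inv_id_assoc]
  rfl

/-- The isomorphism `(C¹)^• ⟶ C` of `H`-Hom-graded categories, which is the identity on objects and
sends `f : X⟨a⟩ ⟶ Y` to `f ∘ r_{X,a}`. -/
abbrev ofDegOneBullet : HomGradedFunctor (degOneMod σ).bulletCat C where
  obj X := X.as
  map {a X Y} :=
    { toFun := fun f => C.comp (one_mul a) (C.bulletUnHom σ f) (σ X.as a).iso.hom
      map_add' := fun f g => (C.comp (one_mul a)).map_add₂ (C.bulletUnHom σ f)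
        (C.bulletUnHom σ g) _
      map_smul' := fun r f => (C.comp (one_mul a)).map_smul₂ r (C.bulletUnHom σ f) _ }
  map_id X := by
    change C.comp _ (DegOne.unHom (shiftUnitApp σ X).inv) (σ X.as 1).iso.hom = C.id X.as
    refine toHomog_injective ?_
    rw [toHomog_comp, toHomog_id]
    -- `r_{X,1}⁻¹` has degree `1⁻¹`, so the inverse of the unit contains an extra identity factor
    -- that corrects the degree to `1`; it disappears in `Homog`.
    have h : toHomog (DegOne.unHom (shiftUnitApp σ X).inv) = (σ X.as 1).iso.toIso.inv := by
      change toHomog (C.comp _ (C.id X.as) (σ X.as 1).iso.inv) = _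
      rw [toHomog_comp, toHomog_inv, toHomog_id, Category.comp_id]
    rw [h, toHomog_hom, Iso.hom_inv_id]
  map_comp {a b c X Y Z} p g f := by
    refine toHomog_injective ?_
    refine (toHomog_comp _ _ _).trans ((C.toHomog_bulletUnHom_comp σ p g f).trans ?_)
    rw [toHomog_comp]
    exact congrArg₂ (· ≫ ·) (toHomog_comp _ _ _).symm (toHomog_comp _ _ _).symm

/-- Precomposition with the isomorphism `r_{X,a}` can be cancelled, so the functor laws of the
inverse can be tested after applying `ofDegOneBullet`. -/
theorem ofDegOneBullet_map_injective {a : H} {X Y : C.DegOne}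
    {f g : (degOneMod σ).bulletCat.Hom a X Y}
    (h : (C.ofDegOneBullet σ).map f = (C.ofDegOneBullet σ).map g) : f = g := by
  refine toHomog_injective (C := C) (f := C.bulletUnHom σ f) (g := C.bulletUnHom σ g) ?_
  have h₁ := congrArg toHomog h
  refine (cancel_epi (σ X.as a).iso.toIso.hom).1 ?_
  exact (toHomog_comp _ _ _).symm.trans (h₁.trans (toHomog_comp _ _ _))

/-- Supplies the preimage `f ∘ r_{X,a}⁻¹`; with injectivity, each map of Hom-modules is bijective.
-/
theorem ofDegOneBullet_map_comp_inv {a : H} {X Y : C.Obj} (f : C.Hom a X Y) :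
    (C.ofDegOneBullet σ).map (X := ⟨X⟩) (Y := ⟨Y⟩)
      (C.comp (mul_inv_cancel a) f (σ X a).iso.inv) = f := by
  change C.comp (one_mul a) (C.comp (mul_inv_cancel a) f (σ X a).iso.inv) (σ X a).iso.hom = f
  rw [C.assoc (mul_inv_cancel a) (inv_mul_cancel a) (one_mul a) (mul_one a),
    (σ X a).iso.hom_inv_id, C.comp_id]

/-- The isomorphism `C ⟶ (C¹)^•` of `H`-Hom-graded categories, inverse to
`HomGradedCat.ofDegOneBullet`. -/
abbrev toDegOneBullet : HomGradedFunctor C (degOneMod σ).bulletCat where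
  obj X := ⟨X⟩
  map {a X Y} :=
    { toFun := fun f => C.comp (mul_inv_cancel a) f (σ X a).iso.inv
      map_add' := fun f g => (C.comp (mul_inv_cancel a)).map_add₂ f g _
      map_smul' := fun r f => (C.comp (mul_inv_cancel a)).map_smul₂ r f _ }
  -- The inverse of a bijective functor is a functor: both laws are pulled back along the faithful
  -- `ofDegOneBullet`.
  map_id X := C.ofDegOneBullet_map_injective σ
    ((C.ofDegOneBullet_map_comp_inv σ (C.id X)).trans ((C.ofDegOneBullet σ).map_id ⟨X⟩).symm)
  map_comp {a b c X Y Z} p g f := C.ofDegOneBullet_map_injective σ (by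
    refine (C.ofDegOneBullet_map_comp_inv σ (C.comp p g f)).trans ?_
    rw [(C.ofDegOneBullet σ).map_comp]
    exact (congrArg₂ (fun x y => C.comp p x y) (C.ofDegOneBullet_map_comp_inv σ g)
      (C.ofDegOneBullet_map_comp_inv σ f)).symm)

theorem ofDegOneBullet_comp_toDegOneBullet :
    (C.ofDegOneBullet σ).comp (C.toDegOneBullet σ) = HomGradedFunctor.id _ :=
  HomGradedFunctor.ext_of_obj rfl fun _ _ _ _ => heq_of_eq
    (C.ofDegOneBullet_map_injective σ (C.ofDegOneBullet_map_comp_inv σ _))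

theorem toDegOneBullet_comp_ofDegOneBullet :
    (C.toDegOneBullet σ).comp (C.ofDegOneBullet σ) = HomGradedFunctor.id C :=
  HomGradedFunctor.ext_of_obj rfl fun _ _ _ f => heq_of_eq (C.ofDegOneBullet_map_comp_inv σ f)

end HomGradedCat

/-! ### Naturality of `(C¹)^• ≅ C` in 1-morphisms and 2-morphisms -/

namespace HomGradedFunctor

open HomGradedCat

variable {C D : HomGradedCat.{v, u} R H}
  (σ : ∀ (X : C.Obj) (a : H), C.Shift X a) (ρ : ∀ (X : D.Obj) (a : H), D.Shift X a)

/-- `(F¹)^•` sends `f` to `F f ∘ F(r_{X,a}) ∘ r_{FX,a}⁻¹`, and the comparison functor of `D`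
precomposes with `r_{FX,a}`. What remains is `F(f ∘ r_{X,a})`. -/
theorem ofDegOneBullet_naturality (F : HomGradedFunctor C D) :
    (F.degOneModFunctor σ ρ).bulletFunctor.comp (D.ofDegOneBullet ρ) =
      (C.ofDegOneBullet σ).comp F :=
  ext_of_obj rfl fun a X _ f => heq_of_eq (toHomog_injective (by
    change toHomog (D.comp (one_mul a) (DegOne.unHom ((F.shiftCompApp σ ρ a X).hom ≫
      F.degOneFunctor.map (DegOne.mkHom (C.bulletUnHom σ f)))) (ρ (F.obj X.as) a).iso.hom) =
      toHomog (F.map (C.comp (one_mul a) (C.bulletUnHom σ f) (σ X.as a).iso.hom))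
    rw [toHomog_comp, DegOne.toHomog_unHom, DegOne.hm_comp, hm_shiftCompApp, toHomog_hom,
      Category.assoc, Iso.hom_inv_id_assoc, F.map_comp, toHomog_comp]
    rfl))

/-- The content of 2-naturality on 2-morphisms: the unit of `D¹` at `FX` is `r_{FX,1}`, so the
factor `ε⁻¹` in `(θ¹)^•` is undone by the precomposition with `r_{FX,1}`. -/
theorem degOneModNatTrans_bulletNatTrans_app {F F' : HomGradedFunctor C D} (θ : F ⟶ F')
    (X : C.DegOne) :
    (whiskerRight (HModFunctor.bulletNatTrans (degOneModNatTrans σ ρ θ))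
      (D.ofDegOneBullet ρ)).app X = θ.app X.as :=
  toHomog_injective (by
    change toHomog (D.comp (one_mul 1) (DegOne.unHom
      ((shiftUnitApp ρ ⟨F.obj X.as⟩).inv ≫ DegOne.mkHom (θ.app X.as)))
        (ρ (F.obj X.as) 1).iso.hom) = _
    have h : DegOne.hm (shiftUnitApp ρ ⟨F.obj X.as⟩).inv =
        (ρ (F.obj X.as) 1).iso.toIso.inv := by
      change toHomog (D.comp _ (D.id _) (ρ (F.obj X.as) 1).iso.inv) = _
      rw [toHomog_comp, toHomog_inv, toHomog_id, Category.comp_id]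
    rw [toHomog_comp, DegOne.toHomog_unHom, DegOne.hm_comp, h, toHomog_hom,
      Iso.hom_inv_id_assoc]
    rfl)

end HomGradedFunctor

end BulletDegOne

/-! ### Equality of strict pseudofunctors -/

namespace CategoryTheory.StrictPseudofunctor

variable {B : Type u₁} [Bicategory.{w₁, v₁} B] {C : Type u₂} [Bicategory.{w₂, v₂} C]

/-- A strict pseudofunctor is determined by its underlying prelax functor. -/
theorem ext_of_toPrelaxFunctor {F K : StrictPseudofunctor B C}
    (h : F.toPrelaxFunctor = K.toPrelaxFunctor) : F = K := by
  obtain ⟨⟨⟨P, mapId, mapComp, _, _, _, _, _⟩, map_id, hId⟩, map_comp, hComp⟩ := F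
  obtain ⟨⟨⟨P', mapId', mapComp', _, _, _, _, _⟩, map_id', hId'⟩, map_comp', hComp'⟩ := K
  obtain rfl : P = P' := h
  -- Strictness forces the unit and composition constraints to be `eqToIso`, so they carry no
  -- further data; the remaining fields are propositions.
  obtain rfl : mapId = mapId' := funext fun X => (hId X).trans (hId' X).symm
  obtain rfl : @mapComp = @mapComp' := by
    funext X Y Z f g
    exact (hComp f g).trans (hComp' f g).symm
  rfl

end CategoryTheory.StrictPseudofunctor

/-! ### Assembly of the two 2-equivalences -/

section TwoEquivalences

variable {R : Type uR} [CommRing R] {H : Type uH} [Group H] {G : Type uG} [Group G]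

/-- The `τ`-versions were built on the underlying data, so objects, 1-morphisms and 2-morphisms
agree definitionally, and strictness takes care of the constraints. -/
theorem degOneTau_comp_forgetMod (σ : ShiftChoice.{v, u} R H) (τ : H →* G) :
    (degOneTau σ τ).comp (forgetMod R τ) = (forgetGraded R τ).comp (degOne σ) :=
  StrictPseudofunctor.ext_of_toPrelaxFunctor rfl

theorem bulletTau_comp_forgetGraded (τ : H →* G) :
    (bulletTau τ).comp (forgetGraded R τ) =
      (forgetMod R τ).comp (bullet : StrictPseudofunctor (HModCat.{v, u} R H) _) :=
  StrictPseudofunctor.ext_of_toPrelaxFunctor rfl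

/-- The 2-equivalence between `H`-Hom-graded categories with shifts and `H`-module categories. -/
def twoEquivalence (σ : ShiftChoice.{v, u} R H) : TwoEquivalence (degOne σ) bullet where
  ν :=
    { app := fun M => M.ofBulletDegOneMod (σ M.bulletShiftCat)
      naturality := fun {M N} F => HModFunctor.ofBulletDegOneMod_naturality F
        (σ M.bulletShiftCat) (σ N.bulletShiftCat)
      naturality₂ := fun {M N F F'} θ => HModFunctor.hom_ext fun X =>
        (HModFunctor.bulletNatTrans_degOneModNatTrans_app (σ M.bulletShiftCat)
          (σ N.bulletShiftCat) θ X).trans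
        -- The naturality square commutes strictly and both composites agree on objects, so
        -- conjugation by `eqToHom` does not change components; the claim is the component identity
        -- above.
        (eq_of_heq (HModFunctor.eqToHom_conj_app
          (HModFunctor.ofBulletDegOneMod_naturality F (σ M.bulletShiftCat) (σ N.bulletShiftCat))
          (HModFunctor.ofBulletDegOneMod_naturality F'
            (σ M.bulletShiftCat) (σ N.bulletShiftCat)).symm
          (HModFunctor.whiskerLeft (M.ofBulletDegOneMod (σ M.bulletShiftCat)) θ) X)).symm }
  ν_isIso M := ⟨M.toBulletDegOneMod (σ M.bulletShiftCat),
    M.ofBulletDegOneMod_comp_toBulletDegOneMod _, M.toBulletDegOneMod_comp_ofBulletDegOneMod _⟩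
  η :=
    { app := fun C => C.ofDegOneBullet (σ C)
      naturality := fun {C D} F => HomGradedFunctor.ofDegOneBullet_naturality (σ C) (σ D) F
      naturality₂ := fun {C D F F'} θ => HomGradedFunctor.hom_ext fun X =>
        (HomGradedFunctor.degOneModNatTrans_bulletNatTrans_app (σ C) (σ D) θ X).trans
        (eq_of_heq (HomGradedFunctor.eqToHom_conj_app
          (HomGradedFunctor.ofDegOneBullet_naturality (σ C) (σ D) F)
          (HomGradedFunctor.ofDegOneBullet_naturality (σ C) (σ D) F').symm
          (HomGradedFunctor.whiskerLeft (C.ofDegOneBullet (σ C)) θ) X)).symm }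
  η_isIso C := ⟨C.toDegOneBullet (σ C),
    C.ofDegOneBullet_comp_toDegOneBullet _, C.toDegOneBullet_comp_ofDegOneBullet _⟩

variable {τ : H →* G}

/-- The isomorphism `((C, α)^•)¹ ⟶ C` of `τ`-module categories. -/
abbrev TauModCat.ofBulletDegOneTauMod (M : TauModCat.{v, u} R τ)
    (σ : ∀ (X : M.bulletCat.Obj) (a : H), M.bulletCat.Shift X a) :
    TauModFunctor (M.bulletTauGraded.degOneTauMod σ) M where
  toHModFunctor := M.toHModCat.ofBulletDegOneMod σ
  -- The functor is the identity on objects, and both 2-functors keep the grading, so source and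
  -- target have the same homogeneous objects.
  homog_obj h := h

/-- The isomorphism `C ⟶ ((C, α)^•)¹` of `τ`-module categories. -/
abbrev TauModCat.toBulletDegOneTauMod (M : TauModCat.{v, u} R τ)
    (σ : ∀ (X : M.bulletCat.Obj) (a : H), M.bulletCat.Shift X a) :
    TauModFunctor M (M.bulletTauGraded.degOneTauMod σ) where
  toHModFunctor := M.toHModCat.toBulletDegOneMod σ
  homog_obj h := h

/-- The isomorphism `(C¹)^• ⟶ C` of `τ`-graded categories. -/
abbrev TauGradedCat.ofDegOneBulletTau (C : TauGradedCat.{v, u} R τ)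
    (σ : ∀ (X : C.Obj) (a : H), C.Shift X a) :
    TauGradedFunctor (C.degOneTauMod σ).bulletTauGraded.toTauGradedCat C where
  toHomGradedFunctor := C.toHomGradedCat.ofDegOneBullet σ
  homog_obj h := h

/-- The isomorphism `C ⟶ (C¹)^•` of `τ`-graded categories. -/
abbrev TauGradedCat.toDegOneBulletTau (C : TauGradedCat.{v, u} R τ)
    (σ : ∀ (X : C.Obj) (a : H), C.Shift X a) :
    TauGradedFunctor C (C.degOneTauMod σ).bulletTauGraded.toTauGradedCat where
  toHomGradedFunctor := C.toHomGradedCat.toDegOneBullet σ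
  homog_obj h := h

/-- Preservation of degrees is a property, not a structure, so the equality of underlying `H`-module
functors is enough. -/
theorem TauModFunctor.ofBulletDegOneTauMod_naturality {M N : TauModCat.{v, u} R τ}
    (F : TauModFunctor M N)
    (σ : ∀ (X : M.bulletCat.Obj) (a : H), M.bulletCat.Shift X a)
    (ρ : ∀ (X : N.bulletCat.Obj) (a : H), N.bulletCat.Shift X a) :
    TauModFunctor.comp (F.bulletTauFunctor.degOneTauFunctor σ ρ) (N.ofBulletDegOneTauMod ρ) =
      TauModFunctor.comp (M.ofBulletDegOneTauMod σ) F :=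
  TauModFunctor.ext' (HModFunctor.ofBulletDegOneMod_naturality F.toHModFunctor σ ρ)

theorem TauGradedFunctor.ofDegOneBulletTau_naturality {C D : TauGradedCat.{v, u} R τ}
    (F : TauGradedFunctor C D)
    (σ : ∀ (X : C.Obj) (a : H), C.Shift X a) (ρ : ∀ (X : D.Obj) (a : H), D.Shift X a) :
    TauGradedFunctor.comp (F.degOneTauFunctor σ ρ).bulletTauFunctor (D.ofDegOneBulletTau ρ) =
      TauGradedFunctor.comp (C.ofDegOneBulletTau σ) F :=
  TauGradedFunctor.ext'
    (HomGradedFunctor.ofDegOneBullet_naturality σ ρ F.toHomGradedFunctor)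

/-- The 2-equivalence between `τ`-graded categories with shifts and `τ`-module categories. -/
def twoEquivalenceTau (σ : ShiftChoice.{v, u} R H) (τ : H →* G) :
    TwoEquivalence (degOneTau σ τ) (bulletTau τ) where
  ν :=
    { app := fun M => M.ofBulletDegOneTauMod (σ M.bulletShiftCat)
      naturality := fun {M N} F => TauModFunctor.ofBulletDegOneTauMod_naturality F
        (σ M.bulletShiftCat) (σ N.bulletShiftCat)
      naturality₂ := fun {M N F F'} θ => HModFunctor.hom_ext fun X =>
        (HModFunctor.bulletNatTrans_degOneModNatTrans_app (σ M.bulletShiftCat)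
          (σ N.bulletShiftCat) θ X).trans
        (eq_of_heq (TauModFunctor.eqToHom_conj
          (TauModFunctor.ofBulletDegOneTauMod_naturality F
            (σ M.bulletShiftCat) (σ N.bulletShiftCat))
          (TauModFunctor.ofBulletDegOneTauMod_naturality F'
            (σ M.bulletShiftCat) (σ N.bulletShiftCat)).symm
          (HModFunctor.whiskerLeft (M.toHModCat.ofBulletDegOneMod (σ M.bulletShiftCat)) θ)
            X)).symm }
  ν_isIso M := ⟨M.toBulletDegOneTauMod (σ M.bulletShiftCat),
    TauModFunctor.ext' (M.toHModCat.ofBulletDegOneMod_comp_toBulletDegOneMod _),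
    TauModFunctor.ext' (M.toHModCat.toBulletDegOneMod_comp_ofBulletDegOneMod _)⟩
  η :=
    { app := fun C => C.ofDegOneBulletTau (σ C.toHomGradedShiftCat)
      naturality := fun {C D} F => TauGradedFunctor.ofDegOneBulletTau_naturality F
        (σ C.toHomGradedShiftCat) (σ D.toHomGradedShiftCat)
      naturality₂ := fun {C D F F'} θ => HomGradedFunctor.hom_ext fun X =>
        (HomGradedFunctor.degOneModNatTrans_bulletNatTrans_app (σ C.toHomGradedShiftCat)
          (σ D.toHomGradedShiftCat) θ X).trans
        (eq_of_heq (TauGradedFunctor.eqToHom_conj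
          (TauGradedFunctor.ofDegOneBulletTau_naturality F (σ C.toHomGradedShiftCat)
            (σ D.toHomGradedShiftCat))
          (TauGradedFunctor.ofDegOneBulletTau_naturality F' (σ C.toHomGradedShiftCat)
            (σ D.toHomGradedShiftCat)).symm
          (HomGradedFunctor.whiskerLeft
            (C.toHomGradedCat.ofDegOneBullet (σ C.toHomGradedShiftCat)) θ) X)).symm }
  η_isIso C := ⟨C.toDegOneBulletTau (σ C.toHomGradedShiftCat),
    TauGradedFunctor.ext' (C.toHomGradedCat.ofDegOneBullet_comp_toDegOneBullet _),
    TauGradedFunctor.ext' (C.toHomGradedCat.toDegOneBullet_comp_ofDegOneBullet _)⟩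

end TwoEquivalences

theorem theorem4 {R : Type uR} [CommRing R] [Nontrivial R] {H : Type uH} [Group H]
    {G : Type uG} [Group G] (τ : H →* G) (σ : ShiftChoice.{v, u} R H) :
    -- the 2-functors for `τ` lie over those between `Cat^{H,⟨⟩}` and `H`-module categories
    (degOneTau σ τ).comp (forgetMod R τ) = (forgetGraded R τ).comp (degOne σ) ∧
    (bulletTau τ).comp (forgetGraded R τ) = (forgetMod R τ).comp (bullet : StrictPseudofunctor (HModCat.{v, u} R H) _) ∧
    ∃ (e : TwoEquivalence (degOne σ) bullet) (eτ : TwoEquivalence (degOneTau σ τ) (bulletTau τ)),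
      (∀ M : TauModCat.{v, u} R τ, (forgetMod R τ).map (eτ.ν.app M) = e.ν.app ((forgetMod R τ).obj M)) ∧
      (∀ C : TauGradedShiftCat.{v, u} R τ, (forgetGraded R τ).map (eτ.η.app C) = e.η.app ((forgetGraded R τ).obj C)) := by
  -- The lifting conditions hold definitionally, since each component of `twoEquivalenceTau` has the
  -- corresponding component of `twoEquivalence` as its underlying functor, for the same chosen
  -- shifts.
  exact ⟨degOneTau_comp_forgetMod σ τ, bulletTau_comp_forgetGraded τ, twoEquivalence σ,
    twoEquivalenceTau σ τ, fun _ => rfl, fun _ => rfl⟩
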